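/- **Theorem (convergence of the $\pi$ method).** Let $X\neq\{0\}$ be a complex Banach space, let $E:=\ell^2(\mathbb Z,X)$ with norm $\|x\|=(\sum_{j\in\mathbb Z}\|x_j\|_X^2)^{1/2}$, and let $A$ be a bounded linear operator on $E$ with matrix representation $[a_{i,j}]_{i,j\in\mathbb Z}$, $a_{i,j}\in L(X)$, that is tridiagonal, i.e. $a_{i,j}=0$ for $|i-j|>1$. Write $\alpha_j:=a_{j+1,j}$, $\gamma_j:=a_{j-1,j}$, $\|\alpha\|_\infty:=\sup_j\|\alpha_j\|$, $\|\gamma\|_\infty:=\sup_j\|\gamma_j\|$. For a bounded operator $B$ on a complex Banach space $Y\ne\{0\}$ let $\operatorname{spec}_\varepsilon B:=\{\lambda\in\mathbb C: 1/\|(B-\lambda I)^{-1}\|<\varepsilon\}$ for $\varepsilon>0$, and $\operatorname{Spec}_\varepsilon B:=\{\lambda\in\mathbb C: 1/\|(B-\lambda I)^{-1}\|\le\varepsilon\}$ for $\varepsilon\ge0$, where $1/\|(B-\lambda I)^{-1}\|:=0$ if $B-\lambda I$ is not invertible; thus $\operatorname{Spec}_0B$ is the spectrum $\operatorname{Spec}B$.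 Let $t\in\mathbb C$ with $|t|=1$. For $n\in\mathbb N=\{1,2,\dots\}$ and $k\in\mathbb Z$ let $A^{\mathrm{per},t}_{n,k}$ be the operator on $X^n$, with the norm $(\sum_{j=1}^n\|\xi_j\|_X^2)^{1/2}$, given by the $n\times n$ matrix whose entry in row $i$ and column $j$ is $a_{k+i,k+j}+\delta_{i,1}\delta_{j,n}\,t\,\alpha_k+\delta_{i,n}\delta_{j,1}\,\bar t\,\gamma_{k+n+1}$. Set $$\pi^{n,t}_\varepsilon(A):=\bigcup_{k\in\mathbb Z}\operatorname{spec}_\varepsilon A^{\mathrm{per},t}_{n,k}\ (\varepsilon>0),\qquad \Pi^{n,t}_\varepsilon(A):=\overline{\bigcup_{k\in\mathbb Z}\operatorname{Spec}_\varepsilon A^{\mathrm{per},t}_{n,k}}\ (\varepsilon\ge0),\qquad \varepsilon_n':=2(\|\alpha\|_\infty+\|\gamma\|_\infty)\sin\frac{\pi}{2n}.$$ Suppose that: * $X$ has Globevnik's property: $X$ is finite-dimensional, or $X$ or its dual $X^*$ is complex uniformly convex, where a complex normed space $Y$ is *complex uniformly convex* if for every $\varepsilon>0$ there is $\delta>0$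 such that $\|x\|\le1-\delta$ for all $x,y\in Y$ with $\|y\|\ge\varepsilon$ and $\|x+\zeta y\|\le1$ for all $\zeta\in\mathbb C$ with $|\zeta|\le1$; * the $\pi$ method with parameter $t$ does not suffer from spectral pollution for $A$: there is a sequence of positive numbers $\eta_n\to0$ such that, for every $\varepsilon>0$, $\operatorname{spec}_\varepsilon A^{\mathrm{per},t}_{n,k}\subset\operatorname{spec}_{\varepsilon+\eta_n}A$ for all $n\in\mathbb N$ and $k\in\mathbb Z$. Then, as $n\to\infty$, $\Pi^{n,t}_{\varepsilon+\varepsilon_n'}(A)\to\operatorname{Spec}_\varepsilon A$ for every $\varepsilon\ge0$ (in particular $\Pi^{n,t}_{\varepsilon_n'}(A)\to\operatorname{Spec}A$), where in the case $\varepsilon=0$ it is assumed in addition that $X$ is finite-dimensional or that $\alpha_j\neq0$ or $\gamma_j\ne0$ for some $j\in\mathbb Z$; and $\pi^{n,t}_{\varepsilon+\varepsilon_n'}(A)\to\operatorname{spec}_\varepsilon A$ for every $\varepsilon>0$. Here $S_n\to S$ means that $S$ and all $S_n$, $n\in\mathbb N$, are bounded non-empty subsets of $\mathbb C$ and that the Hausdorff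 distance of $S_n$ and $S$ tends to $0$. -/

import Mathlib

open Filter Topology

noncomputable section

/-! ### Spectral quantities of a bounded operator on a complex Banach space -/

open scoped Classical in
/-- `1 / ‖B⁻¹‖`, with the conventions `‖B⁻¹‖ = ∞` if `B` is not invertible, and `1 / ∞ = 0`. -/
def recipNormInv {Y : Type*} [NormedAddCommGroup Y] [NormedSpace ℂ Y] (B : Y →L[ℂ] Y) : ℝ :=
  if IsUnit B then 1 / ‖Ring.inverse B‖ else 0

/-- The open `ε`-pseudospectrum `{lam : 1 / ‖(B - lam I)⁻¹‖ < ε}`. -/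
def openPseudospectrum {Y : Type*} [NormedAddCommGroup Y] [NormedSpace ℂ Y]
    (ε : ℝ) (B : Y →L[ℂ] Y) : Set ℂ :=
  {lam | recipNormInv (B - lam • ContinuousLinearMap.id ℂ Y) < ε}

/-- The closed `ε`-pseudospectrum `{lam : 1 / ‖(B - lam I)⁻¹‖ ≤ ε}`. For `ε = 0` (and `Y ≠ 0`) this
is the spectrum of `B`, see `closedPseudospectrum_zero`. -/
def closedPseudospectrum {Y : Type*} [NormedAddCommGroup Y] [NormedSpace ℂ Y]
    (ε : ℝ) (B : Y →L[ℂ] Y) : Set ℂ :=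
  {lam | recipNormInv (B - lam • ContinuousLinearMap.id ℂ Y) ≤ ε}

theorem recipNormInv_le_zero_iff {Y : Type*} [NormedAddCommGroup Y] [NormedSpace ℂ Y]
    [Nontrivial Y] (B : Y →L[ℂ] Y) : recipNormInv B ≤ 0 ↔ ¬ IsUnit B := by
  unfold recipNormInv
  split_ifs with h
  · have : Ring.inverse B ≠ 0 := by
      intro h0
      have h1 := Ring.mul_inverse_cancel B h
      rw [h0, mul_zero] at h1
      exact zero_ne_one h1
    have h2 : 0 < ‖Ring.inverse B‖ := norm_pos_iff.mpr this
    have h3 : 0 < 1 / ‖Ring.inverse B‖ := by positivity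
    simp only [h, not_true_eq_false, iff_false, not_le]
    exact h3
  · simp [h]

theorem closedPseudospectrum_zero {Y : Type*} [NormedAddCommGroup Y] [NormedSpace ℂ Y]
    [Nontrivial Y] (B : Y →L[ℂ] Y) : closedPseudospectrum 0 B = spectrum ℂ B := by
  ext lam
  have h : algebraMap ℂ (Y →L[ℂ] Y) lam - B = -(B - lam • ContinuousLinearMap.id ℂ Y) := by
    rw [neg_sub]
    rfl
  rw [closedPseudospectrum, Set.mem_ofPred_eq, recipNormInv_le_zero_iff, spectrum.mem_iff, h,
    IsUnit.neg_iff]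

/-! ### Globevnik's property -/

/-- Complex uniform convexity (uniform `c`-convexity) of a complex normed space. -/
def ComplexUniformlyConvex (Y : Type*) [NormedAddCommGroup Y] [NormedSpace ℂ Y] : Prop :=
  ∀ ε : ℝ, 0 < ε → ∃ δ : ℝ, 0 < δ ∧ ∀ x y : Y, ε ≤ ‖y‖ →
    (∀ ζ : ℂ, ‖ζ‖ ≤ 1 → ‖x + ζ • y‖ ≤ 1) → ‖x‖ ≤ 1 - δ

/-- Globevnik's property: `Y` is finite-dimensional, or `Y` or its dual is complex uniformly
convex. -/
def GlobevnikProperty (Y : Type*) [NormedAddCommGroup Y] [NormedSpace ℂ Y] : Prop :=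
  FiniteDimensional ℂ Y ∨ ComplexUniformlyConvex Y ∨ ComplexUniformlyConvex (StrongDual ℂ Y)

/-! ### Hausdorff convergence -/

/-- `S n → T` in the Hausdorff (pseudo)metric, for a sequence `S 1, S 2, …` of non-empty bounded
subsets of `ℂ` and a non-empty bounded set `T ⊆ ℂ`; the value `S 0` plays no role. -/
def HausdorffConverges (S : ℕ → Set ℂ) (T : Set ℂ) : Prop :=
  (∀ n : ℕ, 1 ≤ n → (S n).Nonempty ∧ Bornology.IsBounded (S n)) ∧
  T.Nonempty ∧ Bornology.IsBounded T ∧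
  Tendsto (fun n => Metric.hausdorffDist (S n) T) atTop (𝓝 0)

/-! ### Operators on `E = ℓ²(ℤ, X)` and their matrix representations -/

/-- The space `E = ℓ²(ℤ, X)`. -/
abbrev EllTwo (X : Type*) [NormedAddCommGroup X] : Type _ := lp (fun _ : ℤ => X) 2

/-- The entry `a_{i,j} ∈ L(X)` of the matrix representation of `A ∈ L(E)`. -/
def matrixEntry {X : Type*} [NormedAddCommGroup X] [NormedSpace ℂ X]
    (A : EllTwo X →L[ℂ] EllTwo X) (i j : ℤ) : X →L[ℂ] X :=
  (lp.evalCLM ℂ (fun _ : ℤ => X) 2 i).comp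
    (A.comp (lp.singleContinuousLinearMap ℂ (fun _ : ℤ => X) 2 j))

theorem norm_matrixEntry_le {X : Type*} [NormedAddCommGroup X] [NormedSpace ℂ X]
    (A : EllTwo X →L[ℂ] EllTwo X) (i j : ℤ) : ‖matrixEntry A i j‖ ≤ ‖A‖ := by
  refine ContinuousLinearMap.opNorm_le_bound _ (norm_nonneg _) fun x => ?_
  calc ‖matrixEntry A i j x‖ = ‖(A (lp.single 2 j x) : EllTwo X) i‖ := rfl
    _ ≤ ‖A (lp.single 2 j x)‖ := lp.norm_apply_le_norm (by simp) _ _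
    _ ≤ ‖A‖ * ‖(lp.single 2 j x : EllTwo X)‖ := A.le_opNorm _
    _ = ‖A‖ * ‖x‖ := by rw [lp.norm_single (by simp)]

/-- The matrix representation of `A` is tridiagonal. -/
def IsTridiagonal {X : Type*} [NormedAddCommGroup X] [NormedSpace ℂ X]
    (A : EllTwo X →L[ℂ] EllTwo X) : Prop :=
  ∀ i j : ℤ, 1 < |i - j| → matrixEntry A i j = 0

/-- The subdiagonal `α_j = a_{j+1,j}`. -/
def subdiag {X : Type*} [NormedAddCommGroup X] [NormedSpace ℂ X]
    (A : EllTwo X →L[ℂ] EllTwo X) (j : ℤ) : X →L[ℂ] X :=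
  matrixEntry A (j + 1) j

/-- The superdiagonal `γ_j = a_{j-1,j}`. -/
def superdiag {X : Type*} [NormedAddCommGroup X] [NormedSpace ℂ X]
    (A : EllTwo X →L[ℂ] EllTwo X) (j : ℤ) : X →L[ℂ] X :=
  matrixEntry A (j - 1) j

/-- The norm `‖x‖_∞ = sup_j ‖x_j‖` of a (bounded) sequence in `L(X)`. -/
def supNorm {X : Type*} [NormedAddCommGroup X] [NormedSpace ℂ X] (x : ℤ → X →L[ℂ] X) : ℝ :=
  ⨆ j : ℤ, ‖x j‖

theorem bddAbove_subdiag {X : Type*} [NormedAddCommGroup X] [NormedSpace ℂ X]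
    (A : EllTwo X →L[ℂ] EllTwo X) : BddAbove (Set.range fun j => ‖subdiag A j‖) :=
  ⟨‖A‖, by rintro _ ⟨j, rfl⟩; exact norm_matrixEntry_le A _ _⟩

theorem bddAbove_superdiag {X : Type*} [NormedAddCommGroup X] [NormedSpace ℂ X]
    (A : EllTwo X →L[ℂ] EllTwo X) : BddAbove (Set.range fun j => ‖superdiag A j‖) :=
  ⟨‖A‖, by rintro _ ⟨j, rfl⟩; exact norm_matrixEntry_le A _ _⟩

/-- The operator on `X^n`, with the norm `(∑ ‖x_j‖²)^{1/2}`, of multiplication by an `n × n` matrix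
with entries in `L(X)`. -/
def blockOperator {X : Type*} [NormedAddCommGroup X] [NormedSpace ℂ X] {n : ℕ}
    (M : Fin n → Fin n → X →L[ℂ] X) :
    PiLp 2 (fun _ : Fin n => X) →L[ℂ] PiLp 2 (fun _ : Fin n => X) :=
  ((PiLp.continuousLinearEquiv 2 ℂ (fun _ : Fin n => X)).symm :
      (Fin n → X) →L[ℂ] PiLp 2 (fun _ : Fin n => X)).comp
    (ContinuousLinearMap.pi fun i =>
      ∑ j, (M i j).comp (PiLp.proj (𝕜 := ℂ) 2 (fun _ : Fin n => X) j))

theorem blockOperator_apply {X : Type*} [NormedAddCommGroup X] [NormedSpace ℂ X] {n : ℕ}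
    (M : Fin n → Fin n → X →L[ℂ] X) (x : PiLp 2 (fun _ : Fin n => X)) (i : Fin n) :
    blockOperator M x i = ∑ j, M i j (x j) := by
  simp [blockOperator]

/-! ### The `π` method -/

/-- The periodised finite section `A_{n,k}^{per,t} = A_{n,k} + B_{n,k}^t`, where `A_{n,k}` consists
of rows and columns `k+1, …, k+n` of `A`, and `B_{n,k}^t` has the entry `t α_k` added in the top
right corner and the entry `t̄ γ_{k+n+1}` in the bottom left corner (`Fin n` counts from `0`). -/
def periodisedSection {X : Type*} [NormedAddCommGroup X] [NormedSpace ℂ X]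
    (A : EllTwo X →L[ℂ] EllTwo X) (t : ℂ) (n : ℕ) (k : ℤ) :
    PiLp 2 (fun _ : Fin n => X) →L[ℂ] PiLp 2 (fun _ : Fin n => X) :=
  blockOperator fun i j : Fin n =>
    matrixEntry A (k + 1 + (i : ℕ)) (k + 1 + (j : ℕ))
      + (if (i : ℕ) = 0 ∧ (j : ℕ) + 1 = n then t • subdiag A k else 0)
      + (if (i : ℕ) + 1 = n ∧ (j : ℕ) = 0 then star t • superdiag A (k + n + 1) else 0)

/-- `π^{n,t}_ε(A)`, the union over `k` of the open `ε`-pseudospectra of `A_{n,k}^{per,t}`. -/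
def piOpen {X : Type*} [NormedAddCommGroup X] [NormedSpace ℂ X]
    (A : EllTwo X →L[ℂ] EllTwo X) (t : ℂ) (n : ℕ) (ε : ℝ) : Set ℂ :=
  ⋃ k : ℤ, openPseudospectrum ε (periodisedSection A t n k)

/-- `Π^{n,t}_ε(A)`, the closure of the union over `k` of the closed `ε`-pseudospectra of
`A_{n,k}^{per,t}`. -/
def piClosed {X : Type*} [NormedAddCommGroup X] [NormedSpace ℂ X]
    (A : EllTwo X →L[ℂ] EllTwo X) (t : ℂ) (n : ℕ) (ε : ℝ) : Set ℂ :=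
  closure (⋃ k : ℤ, closedPseudospectrum ε (periodisedSection A t n k))

/-- The penalty term `ε'_n = 2 (‖α‖_∞ + ‖γ‖_∞) sin (π / (2n))`. -/
def piPenalty {X : Type*} [NormedAddCommGroup X] [NormedSpace ℂ X]
    (A : EllTwo X →L[ℂ] EllTwo X) (n : ℕ) : ℝ :=
  2 * (supNorm (subdiag A) + supNorm (superdiag A)) * Real.sin (Real.pi / (2 * n))

/-- The `π` method with parameter `t` does not suffer from spectral pollution for `A`: for some
positive null sequence `η_1, η_2, …`, the open `ε`-pseudospectrum of every `A_{n,k}^{per,t}` is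
contained in the open `(ε + η_n)`-pseudospectrum of `A`, for every `ε > 0`. -/
def PiNoSpectralPollution {X : Type*} [NormedAddCommGroup X] [NormedSpace ℂ X]
    (A : EllTwo X →L[ℂ] EllTwo X) (t : ℂ) : Prop :=
  ∃ η : ℕ → ℝ, (∀ n : ℕ, 1 ≤ n → 0 < η n) ∧ Tendsto η atTop (𝓝 0) ∧
    ∀ ε : ℝ, 0 < ε → ∀ n : ℕ, 1 ≤ n → ∀ k : ℤ,
      openPseudospectrum ε (periodisedSection A t n k) ⊆ openPseudospectrum (ε + η n) A

end

/-
Let `x` be an approximate eigenvector of `A` for `λ` with residual less than `ε`, and weight the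
coordinates `k + 1, …, k + n` of `x` by `sin (π i / n)`, `i = 1, …, n`. The squared norms of these
windows, over all `k`, add up to a multiple of `‖x‖ ^ 2`. The weight vanishes at `i = 0` and
`i = n`, so the corner `t α_k` acts on `0`, the corner `t̄ γ_{k+n+1}` is controlled by the
difference of the weights at `n` and `n + 1`, and by Minkowski's inequality the errors made by
moving the weights past `A` cost no more than `ε'_n`. Hence some window is an approximate
eigenvector of `A_{n,k}^{per,t}` with residual less than `ε + ε'_n`; approximate eigenvectors of
the transpose are treated alike.

A closed pseudospectrum also needs the points where `1 / ‖(A - λ)⁻¹‖` equals `ε`. If such a point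
were outside the closed union of the pseudospectra of the `A_{n,k}^{per,t}`, Globevnik's property
would force their resolvent norms to stay below `1 / (ε + ε'_n)` by a margin independent of `k`,
contrary to the first part applied with a slightly larger `ε`. The opposite inclusion is the absence
of spectral pollution together with compactness.
-/

/-! ### Lower bounds for operators and their transposes -/

section RecipNormInv

variable {Y : Type*} [NormedAddCommGroup Y] [NormedSpace ℂ Y]

theorem mem_openPseudospectrum {ε : ℝ} {B : Y →L[ℂ] Y} {lam : ℂ} :
    lam ∈ openPseudospectrum ε B ↔ recipNormInv (B - lam • 1) < ε := Iff.rfl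

theorem mem_closedPseudospectrum {ε : ℝ} {B : Y →L[ℂ] Y} {lam : ℂ} :
    lam ∈ closedPseudospectrum ε B ↔ recipNormInv (B - lam • 1) ≤ ε := Iff.rfl

theorem add_mem_closedPseudospectrum {ε : ℝ} {B : Y →L[ℂ] Y} {lam μ : ℂ} :
    lam + μ ∈ closedPseudospectrum ε B ↔ recipNormInv (B - lam • 1 - μ • 1) ≤ ε := by
  rw [mem_closedPseudospectrum, add_smul, sub_sub]

theorem openPseudospectrum_subset_closedPseudospectrum (ε : ℝ) (B : Y →L[ℂ] Y) :
    openPseudospectrum ε B ⊆ closedPseudospectrum ε B := fun _ h =>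
  mem_closedPseudospectrum.2 (mem_openPseudospectrum.1 h).le

theorem recipNormInv_nonneg (B : Y →L[ℂ] Y) : 0 ≤ recipNormInv B := by
  unfold recipNormInv
  split_ifs <;> positivity

theorem isUnit_of_recipNormInv_pos {B : Y →L[ℂ] Y} (h : 0 < recipNormInv B) : IsUnit B := by
  by_contra h'
  simp [recipNormInv, h'] at h

theorem le_recipNormInv_iff_mul_norm_inverse_le [Nontrivial Y] {s : ℝ} (hs : 0 < s)
    (B : Y →L[ℂ] Y) : s ≤ recipNormInv B ↔ IsUnit B ∧ s * ‖Ring.inverse B‖ ≤ 1 := by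
  unfold recipNormInv
  split_ifs with hB
  · have hpos : 0 < ‖Ring.inverse B‖ := norm_pos_iff.2 hB.ringInverse.ne_zero
    simp only [le_div_iff₀ hpos, hB, true_and]
  · simp [hB, hs]

theorem mul_norm_le_norm_apply [Nontrivial Y] {s : ℝ} {B : Y →L[ℂ] Y}
    (h : s ≤ recipNormInv B) (y : Y) : s * ‖y‖ ≤ ‖B y‖ := by
  rcases le_or_gt s 0 with hs | hs
  · exact (mul_nonpos_of_nonpos_of_nonneg hs (norm_nonneg y)).trans (norm_nonneg _)
  obtain ⟨hB, hle⟩ := (le_recipNormInv_iff_mul_norm_inverse_le hs B).1 h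
  have hy : Ring.inverse B (B y) = y :=
    DFunLike.congr_fun (Ring.inverse_mul_cancel B hB) y
  calc s * ‖y‖ = s * ‖Ring.inverse B (B y)‖ := by rw [hy]
    _ ≤ s * (‖Ring.inverse B‖ * ‖B y‖) := by gcongr; exact ContinuousLinearMap.le_opNorm _ _
    _ = s * ‖Ring.inverse B‖ * ‖B y‖ := by ring
    _ ≤ ‖B y‖ := mul_le_of_le_one_left (norm_nonneg _) hle

theorem mul_norm_le_norm_comp [Nontrivial Y] {s : ℝ} {B : Y →L[ℂ] Y}
    (h : s ≤ recipNormInv B) (φ : StrongDual ℂ Y) : s * ‖φ‖ ≤ ‖φ.comp B‖ := by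
  rcases le_or_gt s 0 with hs | hs
  · exact (mul_nonpos_of_nonpos_of_nonneg hs (norm_nonneg φ)).trans (norm_nonneg _)
  obtain ⟨hB, hle⟩ := (le_recipNormInv_iff_mul_norm_inverse_le hs B).1 h
  have hφ : (φ.comp B).comp (Ring.inverse B) = φ := by
    rw [ContinuousLinearMap.comp_assoc]
    exact congrArg φ.comp (Ring.mul_inverse_cancel B hB)
  calc s * ‖φ‖ = s * ‖(φ.comp B).comp (Ring.inverse B)‖ := by rw [hφ]
    _ ≤ s * (‖φ.comp B‖ * ‖Ring.inverse B‖) := by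
      gcongr; exact ContinuousLinearMap.opNorm_comp_le _ _
    _ = s * ‖Ring.inverse B‖ * ‖φ.comp B‖ := by ring
    _ ≤ ‖φ.comp B‖ := mul_le_of_le_one_left (norm_nonneg _) hle

theorem exists_dual_ne_zero_comp_eq_zero {B : Y →L[ℂ] Y} (h : B.range.topologicalClosure ≠ ⊤) :
    ∃ φ : StrongDual ℂ Y, φ ≠ 0 ∧ φ.comp B = 0 := by
  set p := B.range.topologicalClosure
  have : IsClosed (p : Set Y) := B.range.isClosed_topologicalClosure
  obtain ⟨x, -, hx⟩ := SetLike.exists_of_lt h.lt_top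
  obtain ⟨φ, hφ⟩ := SeparatingDual.exists_ne_zero (R := ℂ) (x := p.mkQL x) (by simpa using hx)
  refine ⟨φ.comp p.mkQL, fun h0 => hφ (DFunLike.congr_fun h0 x), ?_⟩
  ext y
  have hy : p.mkQL (B y) = 0 := by
    simpa using B.range.le_topologicalClosure (LinearMap.mem_range_self (B : Y →ₗ[ℂ] Y) y)
  simp [hy]

theorem le_recipNormInv_of_isUnit [Nontrivial Y] {s : ℝ} (hs : 0 < s) {B : Y →L[ℂ] Y}
    (hB : IsUnit B) (h : ∀ y, s * ‖y‖ ≤ ‖B y‖) : s ≤ recipNormInv B := by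
  refine (le_recipNormInv_iff_mul_norm_inverse_le hs B).2 ⟨hB, ?_⟩
  rw [← le_div_iff₀' hs]
  refine ContinuousLinearMap.opNorm_le_bound _ (by positivity) fun y => ?_
  have hy : B (Ring.inverse B y) = y := DFunLike.congr_fun (Ring.mul_inverse_cancel B hB) y
  have := h (Ring.inverse B y)
  rwa [hy, ← le_div_iff₀' hs, div_eq_mul_one_div, mul_comm] at this

theorem le_recipNormInv_of_isUnit_of_comp [Nontrivial Y] {s : ℝ} (hs : 0 < s) {B : Y →L[ℂ] Y}
    (hB : IsUnit B) (h : ∀ φ : StrongDual ℂ Y, s * ‖φ‖ ≤ ‖φ.comp B‖) : s ≤ recipNormInv B := by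
  refine le_recipNormInv_of_isUnit hs hB fun y => ?_
  obtain ⟨φ, hφ, hφy⟩ := exists_dual_vector'' ℂ y
  set ψ := φ.comp (Ring.inverse B) with hψ
  have hψB : ψ.comp B = φ := by
    rw [hψ, ContinuousLinearMap.comp_assoc]
    exact (congrArg φ.comp (Ring.inverse_mul_cancel B hB)).trans φ.comp_id
  have hy : ψ (B y) = ‖y‖ := by rw [← ContinuousLinearMap.comp_apply, hψB, hφy]; rfl
  calc s * ‖y‖ = s * ‖ψ (B y)‖ := by rw [hy, Complex.norm_real, norm_norm]
    _ ≤ s * (‖ψ‖ * ‖B y‖) := by gcongr; exact ψ.le_opNorm _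
    _ = s * ‖ψ‖ * ‖B y‖ := (mul_assoc _ _ _).symm
    _ ≤ 1 * ‖B y‖ := by gcongr; exact (h ψ).trans (hψB ▸ hφ)
    _ = ‖B y‖ := one_mul _

variable [CompleteSpace Y] [Nontrivial Y]

theorem le_recipNormInv_iff {s : ℝ} (hs : 0 < s) (B : Y →L[ℂ] Y) :
    s ≤ recipNormInv B ↔
      (∀ y, s * ‖y‖ ≤ ‖B y‖) ∧ ∀ φ : StrongDual ℂ Y, s * ‖φ‖ ≤ ‖φ.comp B‖ := by
  refine ⟨fun h => ⟨mul_norm_le_norm_apply h, mul_norm_le_norm_comp h⟩, fun ⟨h₁, h₂⟩ => ?_⟩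
  have hdense : B.range.topologicalClosure = ⊤ := by
    by_contra h
    obtain ⟨φ, hφ, hφB⟩ := exists_dual_ne_zero_comp_eq_zero h
    have := h₂ φ
    rw [hφB, norm_zero] at this
    exact absurd this (not_le.2 (mul_pos hs (norm_pos_iff.2 hφ)))
  have hanti : AntilipschitzWith (Real.toNNReal s⁻¹) B := B.antilipschitz_of_bound fun y => by
    rw [Real.coe_toNNReal _ (by positivity), ← div_eq_inv_mul, le_div_iff₀' hs]
    exact h₁ y
  have hB : IsUnit B := ContinuousLinearMap.isUnit_iff_bijective.2
    (B.bijective_iff_dense_range_and_antilipschitz.2 ⟨hdense, _, hanti⟩)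
  exact le_recipNormInv_of_isUnit hs hB h₁

theorem recipNormInv_lt_iff {s : ℝ} (hs : 0 < s) (B : Y →L[ℂ] Y) :
    recipNormInv B < s ↔
      (∃ y, ‖B y‖ < s * ‖y‖) ∨ ∃ φ : StrongDual ℂ Y, ‖φ.comp B‖ < s * ‖φ‖ := by
  rw [← not_le, le_recipNormInv_iff hs, not_and_or]
  push Not
  rfl

theorem recipNormInv_le_add_norm_sub (B C : Y →L[ℂ] Y) :
    recipNormInv B ≤ recipNormInv C + ‖B - C‖ := by
  rw [← sub_le_iff_le_add]
  rcases le_or_gt (recipNormInv B - ‖B - C‖) 0 with h | h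
  · exact h.trans (recipNormInv_nonneg C)
  refine (le_recipNormInv_iff h C).2 ⟨fun y => ?_, fun φ => ?_⟩
  · have hB := mul_norm_le_norm_apply le_rfl (B := B) y
    have hsub : ‖B y‖ - ‖C y‖ ≤ ‖B - C‖ * ‖y‖ :=
      (norm_sub_norm_le _ _).trans ((B - C).le_opNorm y)
    linarith
  · have hB := mul_norm_le_norm_comp le_rfl (B := B) φ
    have hsub : ‖φ.comp B‖ - ‖φ.comp C‖ ≤ ‖φ‖ * ‖B - C‖ := by
      refine (norm_sub_norm_le _ _).trans ?_
      rw [← ContinuousLinearMap.comp_sub]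
      exact φ.opNorm_comp_le _
    linarith

theorem continuous_recipNormInv : Continuous (recipNormInv : (Y →L[ℂ] Y) → ℝ) := by
  refine (LipschitzWith.of_le_add fun B C => ?_).continuous
  simpa only [dist_eq_norm] using recipNormInv_le_add_norm_sub B C

theorem continuous_recipNormInv_sub_smul (B : Y →L[ℂ] Y) :
    Continuous fun lam : ℂ => recipNormInv (B - lam • 1) :=
  continuous_recipNormInv.comp (by fun_prop)

theorem isClosed_closedPseudospectrum (ε : ℝ) (B : Y →L[ℂ] Y) :
    IsClosed (closedPseudospectrum ε B) :=
  isClosed_le (continuous_recipNormInv_sub_smul B) continuous_const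

theorem norm_sub_norm_le_recipNormInv (B : Y →L[ℂ] Y) (lam : ℂ) :
    ‖lam‖ - ‖B‖ ≤ recipNormInv (B - lam • 1) := by
  rcases le_or_gt (‖lam‖ - ‖B‖) 0 with h | h
  · exact h.trans (recipNormInv_nonneg _)
  refine (le_recipNormInv_iff h _).2 ⟨fun y => ?_, fun φ => ?_⟩
  · calc (‖lam‖ - ‖B‖) * ‖y‖ ≤ ‖lam • y‖ - ‖B y‖ := by
          rw [sub_mul, norm_smul]
          gcongr
          exact B.le_opNorm y
      _ ≤ ‖lam • y - B y‖ := norm_sub_norm_le _ _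
      _ = ‖(B - lam • 1) y‖ := norm_sub_rev _ _
  · calc (‖lam‖ - ‖B‖) * ‖φ‖ ≤ ‖lam • φ‖ - ‖φ.comp B‖ := by
          rw [sub_mul, norm_smul, mul_comm ‖B‖]
          gcongr
          exact φ.opNorm_comp_le B
      _ ≤ ‖lam • φ - φ.comp B‖ := norm_sub_norm_le _ _
      _ = ‖φ.comp (B - lam • 1)‖ := by
        rw [norm_sub_rev]
        congr 1
        ext y
        simp

theorem isBounded_closedPseudospectrum (ε : ℝ) (B : Y →L[ℂ] Y) :
    Bornology.IsBounded (closedPseudospectrum ε B) := by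
  refine (Metric.isBounded_closedBall (x := (0 : ℂ)) (r := ‖B‖ + ε)).subset fun lam h => ?_
  rw [mem_closedBall_zero_iff]
  linarith [norm_sub_norm_le_recipNormInv B lam, mem_closedPseudospectrum.1 h]

theorem exists_recipNormInv_sub_smul_eq_zero (B : Y →L[ℂ] Y) :
    ∃ lam : ℂ, recipNormInv (B - lam • 1) = 0 := by
  obtain ⟨lam, h⟩ := spectrum.nonempty B
  rw [← closedPseudospectrum_zero] at h
  exact ⟨lam, le_antisymm h (recipNormInv_nonneg _)⟩

theorem exists_closedPseudospectrum_add_subset_thickening (B : Y →L[ℂ] Y) (ε : ℝ) {δ : ℝ}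
    (hδ : 0 < δ) : ∃ θ : ℝ, 0 < θ ∧
      closedPseudospectrum (ε + θ) B ⊆ Metric.thickening δ (closedPseudospectrum ε B) := by
  set S := closedPseudospectrum (ε + 1) B \ Metric.thickening δ (closedPseudospectrum ε B)
  have hcompact : IsCompact S :=
    (Metric.isCompact_of_isClosed_isBounded (isClosed_closedPseudospectrum _ B)
      (isBounded_closedPseudospectrum _ B)).diff Metric.isOpen_thickening
  have hgt : ∀ lam ∈ S, ε < recipNormInv (B - lam • 1) := fun lam h =>
    not_le.1 fun hle => h.2 (Metric.self_subset_thickening hδ _ hle)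
  obtain ⟨m, hm, hmin⟩ :=
    hcompact.exists_forall_le' (continuous_recipNormInv_sub_smul B).continuousOn hgt
  refine ⟨min 1 ((m - ε) / 2), lt_min one_pos (by linarith), fun lam hlam => ?_⟩
  by_contra hnot
  have hle := mem_closedPseudospectrum.1 hlam
  have hlamS : lam ∈ S :=
    ⟨mem_closedPseudospectrum.2 (hle.trans (by linarith [min_le_left 1 ((m - ε) / 2)])), hnot⟩
  linarith [hmin lam hlamS, min_le_right 1 ((m - ε) / 2)]

end RecipNormInv

/-! ### Square-summable coordinates -/

section SquareSummableCoordinates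

/-- The norm of `Y` is the `ℓ²`-norm of the family of coordinates `T j y`; the coordinates need
not be independent of each other. -/
def IsL2Coord {J Y Z : Type*} [NormedAddCommGroup Y] [NormedSpace ℂ Y] [NormedAddCommGroup Z]
    [NormedSpace ℂ Z] (T : J → Y →L[ℂ] Z) : Prop :=
  ∀ y, HasSum (fun j => ‖T j y‖ ^ 2) (‖y‖ ^ 2)

/-- `Y` is the `ℓ²`-sum of copies of `Z`, with coordinate maps `T j` and embeddings `ι j`. -/
structure IsL2Decomposition {J Y Z : Type*} [NormedAddCommGroup Y] [NormedSpace ℂ Y]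
    [NormedAddCommGroup Z] [NormedSpace ℂ Z] (T : J → Y →L[ℂ] Z) (ι : J → Z →L[ℂ] Y) : Prop where
  coord : IsL2Coord T
  apply_self : ∀ j z, T j (ι j z) = z
  apply_ne : ∀ i j z, i ≠ j → T i (ι j z) = 0
  hasSum : ∀ y, HasSum (fun j => ι j (T j y)) y

variable {J Y Z : Type*} [NormedAddCommGroup Y] [NormedSpace ℂ Y] [NormedAddCommGroup Z]
    [NormedSpace ℂ Z]

/-- The transpose `φ ↦ φ ∘ A` of a bounded operator `A`. -/
noncomputable def dualOperator (A : Y →L[ℂ] Z) : StrongDual ℂ Z →L[ℂ] StrongDual ℂ Y :=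
  ContinuousLinearMap.precomp ℂ A

@[simp]
theorem dualOperator_apply (A : Y →L[ℂ] Z) (φ : StrongDual ℂ Z) :
    dualOperator A φ = φ.comp A := rfl

theorem norm_dualOperator_le (A : Y →L[ℂ] Z) : ‖dualOperator A‖ ≤ ‖A‖ :=
  ContinuousLinearMap.opNorm_le_bound _ (norm_nonneg A) fun φ =>
    (φ.opNorm_comp_le A).trans_eq (mul_comm _ _)

/-- The coordinates `φ ↦ φ ∘ ι j` on the dual space that are induced by the embeddings `ι j`. -/
noncomputable def dualCoord (ι : J → Z →L[ℂ] Y) (j : J) : StrongDual ℂ Y →L[ℂ] StrongDual ℂ Z :=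
  dualOperator (ι j)

@[simp]
theorem dualCoord_apply (ι : J → Z →L[ℂ] Y) (j : J) (φ : StrongDual ℂ Y) :
    dualCoord ι j φ = φ.comp (ι j) := rfl

theorem exists_norm_eq_one_and_apply_smul_eq_norm (φ : StrongDual ℂ Z) (x : Z) :
    ∃ u : ℂ, ‖u‖ = 1 ∧ φ (u • x) = ‖φ x‖ := by
  rcases eq_or_ne (φ x) 0 with h | h
  · exact ⟨1, norm_one, by simp [h]⟩
  · exact ⟨‖φ x‖ / φ x, by simp [h], by simp [h]⟩

theorem exists_norm_le_and_mul_sq_norm_le_apply (φ : StrongDual ℂ Z) {η : ℝ} (hη : η < 1) :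
    ∃ z : Z, ‖z‖ ≤ ‖φ‖ ∧ ∃ a : ℝ, φ z = a ∧ η * ‖φ‖ ^ 2 ≤ a := by
  rcases eq_or_ne φ 0 with rfl | h0
  · exact ⟨0, by simp, 0, by simp, by simp⟩
  have hpos : 0 < ‖φ‖ := norm_pos_iff.2 h0
  obtain ⟨x, hx1, hx⟩ := φ.exists_lt_apply_of_lt_opNorm (mul_lt_of_lt_one_left hpos hη)
  obtain ⟨u, hu, hux⟩ := exists_norm_eq_one_and_apply_smul_eq_norm φ x
  refine ⟨(‖φ‖ : ℂ) • u • x, ?_, ‖φ‖ * ‖φ x‖, ?_, ?_⟩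
  · rw [norm_smul, norm_smul, hu, one_mul, Complex.norm_real, norm_norm]
    exact mul_le_of_le_one_right hpos.le hx1.le
  · rw [map_smul, hux, smul_eq_mul, Complex.ofReal_mul]
  · rw [sq, ← mul_assoc, mul_comm _ ‖φ‖]
    gcongr

theorem IsL2Coord.sum_le {T : J → Y →L[ℂ] Z} (hT : IsL2Coord T) (s : Finset J) (y : Y) :
    ∑ j ∈ s, ‖T j y‖ ^ 2 ≤ ‖y‖ ^ 2 :=
  sum_le_hasSum s (fun _ _ => by positivity) (hT y)

namespace IsL2Decomposition

variable {T : J → Y →L[ℂ] Z} {ι : J → Z →L[ℂ] Y}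

theorem norm_sum_sq (h : IsL2Decomposition T ι) (s : Finset J) (z : J → Z) :
    ‖∑ j ∈ s, ι j (z j)‖ ^ 2 = ∑ j ∈ s, ‖z j‖ ^ 2 := by
  classical
  have hcoord : ∀ i, T i (∑ j ∈ s, ι j (z j)) = if i ∈ s then z i else 0 := fun i => by
    rw [map_sum]
    split_ifs with hi
    · rw [Finset.sum_eq_single_of_mem i hi fun j _ hj => h.apply_ne i j _ hj.symm, h.apply_self]
    · exact Finset.sum_eq_zero fun j hj => h.apply_ne i j _ (by rintro rfl; exact hi hj)
  refine (h.coord _).unique ?_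
  have hz : ∑ j ∈ s, ‖z j‖ ^ 2 = ∑ j ∈ s, ‖T j (∑ i ∈ s, ι i (z i))‖ ^ 2 :=
    Finset.sum_congr rfl fun j hj => by rw [hcoord, if_pos hj]
  rw [hz]
  exact hasSum_sum_of_ne_finset_zero fun j hj => by simp [hcoord, hj]

theorem norm_apply (h : IsL2Decomposition T ι) (j : J) (z : Z) : ‖ι j z‖ = ‖z‖ := by
  have := h.norm_sum_sq {j} fun _ => z
  simpa using this

theorem sum_sq_norm_comp_le (h : IsL2Decomposition T ι) (φ : StrongDual ℂ Y) (s : Finset J) :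
    ∑ j ∈ s, ‖φ.comp (ι j)‖ ^ 2 ≤ ‖φ‖ ^ 2 := by
  set Q := ∑ j ∈ s, ‖φ.comp (ι j)‖ ^ 2 with hQ
  have hQ0 : 0 ≤ Q := Finset.sum_nonneg fun _ _ => by positivity
  have almost : ∀ η : ℝ, η < 1 → η * Q ≤ ‖φ‖ * √Q := fun η hη => by
    choose z hz a ha haz using fun j =>
      exists_norm_le_and_mul_sq_norm_le_apply (φ.comp (ι j)) hη
    have hnorm : ‖∑ j ∈ s, ι j (z j)‖ ≤ √Q := by
      refine Real.le_sqrt_of_sq_le ?_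
      rw [h.norm_sum_sq]
      exact Finset.sum_le_sum fun j _ => by gcongr; exact hz j
    have hφ : φ (∑ j ∈ s, ι j (z j)) = ((∑ j ∈ s, a j : ℝ) : ℂ) := by
      rw [map_sum, Complex.ofReal_sum]
      exact Finset.sum_congr rfl fun j _ => ha j
    calc η * Q ≤ ∑ j ∈ s, a j := by
          rw [hQ, Finset.mul_sum]
          exact Finset.sum_le_sum fun j _ => haz j
      _ ≤ ‖φ (∑ j ∈ s, ι j (z j))‖ := by
        rw [hφ, Complex.norm_real]
        exact le_abs_self _
      _ ≤ ‖φ‖ * √Q := (φ.le_opNorm _).trans (by gcongr)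
  have hQle : Q ≤ ‖φ‖ * √Q := by
    have hlim : Tendsto (fun η : ℝ => η * Q) (𝓝[<] 1) (𝓝 (1 * Q)) :=
      (tendsto_id.mul_const Q).mono_left nhdsWithin_le_nhds
    rw [one_mul] at hlim
    exact le_of_tendsto hlim (eventually_nhdsWithin_of_forall almost)
  nlinarith [sq_nonneg (‖φ‖ - √Q), Real.sq_sqrt hQ0]

theorem isL2Coord_dualCoord (h : IsL2Decomposition T ι) : IsL2Coord (dualCoord ι) := by
  intro φ
  simp only [dualCoord_apply]
  have hs : Summable fun j => ‖φ.comp (ι j)‖ ^ 2 :=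
    summable_of_sum_le (fun _ => by positivity) (h.sum_sq_norm_comp_le φ)
  have hle : ∑' j, ‖φ.comp (ι j)‖ ^ 2 ≤ ‖φ‖ ^ 2 :=
    hs.tsum_le_of_sum_le (h.sum_sq_norm_comp_le φ)
  have hge : ‖φ‖ ≤ √(∑' j, ‖φ.comp (ι j)‖ ^ 2) := by
    refine φ.opNorm_le_bound (Real.sqrt_nonneg _) fun y => ?_
    have hlim : Tendsto (fun s : Finset J => ‖∑ j ∈ s, φ (ι j (T j y))‖) atTop (𝓝 ‖φ y‖) :=
      (continuous_norm.tendsto _).comp ((h.hasSum y).mapL φ)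
    refine le_of_tendsto' hlim fun s => ?_
    calc ‖∑ j ∈ s, φ (ι j (T j y))‖ ≤ ∑ j ∈ s, ‖φ.comp (ι j)‖ * ‖T j y‖ :=
          norm_sum_le_of_le _ fun j _ => (φ.comp (ι j)).le_opNorm _
      _ ≤ √(∑ j ∈ s, ‖φ.comp (ι j)‖ ^ 2) * √(∑ j ∈ s, ‖T j y‖ ^ 2) :=
        Real.sum_mul_le_sqrt_mul_sqrt _ _ _
      _ ≤ √(∑' j, ‖φ.comp (ι j)‖ ^ 2) * √(‖y‖ ^ 2) := by
        gcongr
        · exact hs.sum_le_tsum s fun _ _ => by positivity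
        · exact h.coord.sum_le s y
      _ = _ := by rw [Real.sqrt_sq (norm_nonneg _)]
  have heq : ∑' j, ‖φ.comp (ι j)‖ ^ 2 = ‖φ‖ ^ 2 :=
    hle.antisymm ((Real.le_sqrt (norm_nonneg _) (tsum_nonneg fun _ => by positivity)).1 hge)
  exact heq ▸ hs.hasSum

end IsL2Decomposition

variable {X : Type*} [NormedAddCommGroup X] [NormedSpace ℂ X]

theorem isL2Decomposition_ellTwo :
    IsL2Decomposition (fun j : ℤ => lp.evalCLM ℂ (fun _ : ℤ => X) 2 j)
      (fun j : ℤ => lp.singleContinuousLinearMap ℂ (fun _ : ℤ => X) 2 j) where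
  coord y := by
    have h : HasSum (fun j => ‖y j‖ ^ (2 : ENNReal).toReal) (‖y‖ ^ (2 : ENNReal).toReal) :=
      lp.hasSum_norm (by simp) y
    simp only [ENNReal.toReal_ofNat, Real.rpow_ofNat] at h
    exact h
  apply_self j z := lp.single_apply_self (E := fun _ : ℤ => X) 2 j z
  apply_ne i j z h := lp.single_apply_ne (E := fun _ : ℤ => X) 2 j z h
  hasSum y := lp.hasSum_single (by simp) y

/-- The embedding of the `j`-th coordinate into `X^n`. -/
noncomputable def piLpSingle (X : Type*) [NormedAddCommGroup X] [NormedSpace ℂ X] {n : ℕ}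
    (j : Fin n) : X →L[ℂ] PiLp 2 (fun _ : Fin n => X) :=
  ((PiLp.continuousLinearEquiv 2 ℂ (fun _ : Fin n => X)).symm :
      (Fin n → X) →L[ℂ] PiLp 2 (fun _ : Fin n => X)).comp
    (ContinuousLinearMap.single ℂ (fun _ : Fin n => X) j)

theorem piLpSingle_apply {n : ℕ} (i j : Fin n) (z : X) :
    piLpSingle X j z i = if i = j then z else 0 := by
  simp [piLpSingle]

theorem sum_piLpSingle_apply {n : ℕ} (y : PiLp 2 (fun _ : Fin n => X)) :
    ∑ j, piLpSingle X j (y j) = y := by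
  ext i
  simp [piLpSingle_apply]

theorem isL2Decomposition_piLp {n : ℕ} :
    IsL2Decomposition (fun j : Fin n => PiLp.proj (𝕜 := ℂ) 2 (fun _ : Fin n => X) j)
      (fun j : Fin n => piLpSingle X j) where
  coord y := PiLp.norm_sq_eq_of_L2 (fun _ : Fin n => X) y ▸ hasSum_fintype _
  apply_self j z := by simp [piLpSingle_apply]
  apply_ne i j z h := by simp [piLpSingle_apply, h]
  hasSum y := by
    have := hasSum_fintype fun j => piLpSingle X j (y j)
    rwa [sum_piLpSingle_apply] at this

end SquareSummableCoordinates

/-! ### Averages over roots of unity -/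

section RootsOfUnity

variable {Z : Type*} [NormedAddCommGroup Z] [NormedSpace ℂ Z]

theorem sum_pow_primitiveRoot_pow {M : ℕ} {ω : ℂ} (hω : IsPrimitiveRoot ω M) (k : ℕ) :
    ∑ i ∈ Finset.range M, (ω ^ i) ^ k = if M ∣ k then (M : ℂ) else 0 := by
  simp_rw [← pow_mul, mul_comm _ k, pow_mul]
  split_ifs with h
  · simp [(hω.pow_eq_one_iff_dvd k).2 h]
  · rw [geom_sum_eq (mt (hω.pow_eq_one_iff_dvd k).1 h), ← pow_mul, mul_comm, pow_mul,
      hω.pow_eq_one]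
    simp

theorem sum_pow_smul_polynomial {M : ℕ} {ω : ℂ} (hω : IsPrimitiveRoot ω M) (a : ℕ → Z)
    (m N : ℕ) :
    ∑ i ∈ Finset.range M, (ω ^ i) ^ m • ∑ l ∈ Finset.range N, (ω ^ i) ^ l • a l
      = ∑ l ∈ Finset.range N, (if M ∣ m + l then (M : ℂ) else 0) • a l := by
  simp_rw [Finset.smul_sum, smul_smul, ← pow_add]
  rw [Finset.sum_comm]
  simp_rw [← Finset.sum_smul, sum_pow_primitiveRoot_pow hω]

theorem sum_pow_smul_polynomial_eq_coeff {M N m k : ℕ} {ω : ℂ} (hω : IsPrimitiveRoot ω M)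
    (a : ℕ → Z) (hNM : N ≤ M) (hk : k < N) (hm : M ∣ m + k) :
    ∑ i ∈ Finset.range M, (ω ^ i) ^ m • ∑ l ∈ Finset.range N, (ω ^ i) ^ l • a l
      = (M : ℂ) • a k := by
  rw [sum_pow_smul_polynomial hω, Finset.sum_eq_single_of_mem k (Finset.mem_range.2 hk),
    if_pos hm]
  intro l hl hlk
  have hlN := Finset.mem_range.1 hl
  refine (if_neg fun hd => hlk ?_).symm ▸ zero_smul ℂ (a l)
  have hmod : l ≡ k [MOD M] := Nat.ModEq.add_left_cancel' m
    ((Nat.modEq_zero_iff_dvd.2 hd).trans (Nat.modEq_zero_iff_dvd.2 hm).symm)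
  exact hmod.eq_of_lt_of_lt (hlN.trans_le hNM) (hk.trans_le hNM)

theorem conj_pow_eq_pow_sub {M k : ℕ} (hk : k < M) {z : ℂ} (hz : z ^ M = 1) :
    (starRingEnd ℂ) z ^ k = z ^ (M - k) := by
  rw [← Complex.inv_eq_conj (Complex.norm_eq_one_of_pow_eq_one hz (by omega)), inv_pow]
  refine inv_eq_of_mul_eq_one_left ?_
  rw [← pow_add, Nat.sub_add_cancel hk.le, hz]

theorem sum_sq_norm_polynomial {M N : ℕ} {ω : ℂ} (hω : IsPrimitiveRoot ω M) (hNM : N ≤ M)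
    (b : ℕ → ℂ) :
    ∑ i ∈ Finset.range M, ‖∑ l ∈ Finset.range N, (ω ^ i) ^ l • b l‖ ^ 2
      = M * ∑ k ∈ Finset.range N, ‖b k‖ ^ 2 := by
  have hconj : ∀ i, (starRingEnd ℂ) (∑ k ∈ Finset.range N, (ω ^ i) ^ k • b k)
      = ∑ k ∈ Finset.range N, (starRingEnd ℂ) (b k) * (ω ^ i) ^ (M - k) := fun i => by
    rw [map_sum]
    refine Finset.sum_congr rfl fun k hk => ?_
    rw [smul_eq_mul, map_mul, map_pow, mul_comm, conj_pow_eq_pow_sub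
      ((Finset.mem_range.1 hk).trans_le hNM) (by rw [pow_right_comm, hω.pow_eq_one, one_pow])]
  apply Complex.ofReal_injective
  push_cast
  simp_rw [← Complex.conj_mul', hconj, Finset.sum_mul]
  rw [Finset.sum_comm, Finset.mul_sum]
  refine Finset.sum_congr rfl fun k hk => ?_
  have hkN := Finset.mem_range.1 hk
  have hcoeff := sum_pow_smul_polynomial_eq_coeff hω b hNM hkN (m := M - k)
    (by rw [Nat.sub_add_cancel (hkN.le.trans hNM)])
  rw [mul_left_comm, ← smul_eq_mul (M : ℂ), ← hcoeff, Finset.mul_sum]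
  simp only [smul_eq_mul, mul_assoc]

theorem sum_mul_le_of_sum_sq_eq {I : Type*} {s : Finset I} {κ p : I → ℝ} {c v : ℝ}
    (hκ0 : ∀ i, 0 ≤ κ i) (hκ2 : ∀ i, κ i ≤ 2) (hκ : ∑ i ∈ s, κ i = s.card) (hc0 : 0 ≤ c)
    (hc : s.card * c ≤ ∑ i ∈ s, p i) (hp : ∑ i ∈ s, p i ^ 2 = s.card * v) :
    ∑ i ∈ s, κ i * p i ≤ s.card * (c + 2 * √(v - c ^ 2)) := by
  have hvar : ∑ i ∈ s, |p i - c| ^ 2 ≤ s.card * (v - c ^ 2) := by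
    simp_rw [sq_abs, sub_sq, Finset.sum_add_distrib, Finset.sum_sub_distrib, ← Finset.sum_mul,
      ← Finset.mul_sum, hp, Finset.sum_const, nsmul_eq_mul]
    nlinarith
  have hdev : ∑ i ∈ s, |p i - c| ≤ s.card * √(v - c ^ 2) := by
    rw [← Real.sqrt_sq (Nat.cast_nonneg (α := ℝ) s.card), ← Real.sqrt_mul (sq_nonneg _)]
    refine Real.le_sqrt_of_sq_le (sq_sum_le_card_mul_sum_sq.trans ?_)
    rw [sq, mul_assoc]
    gcongr
  calc ∑ i ∈ s, κ i * p i ≤ ∑ i ∈ s, (κ i * c + 2 * |p i - c|) := by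
        refine Finset.sum_le_sum fun i _ => ?_
        have hdev_i := mul_le_mul (hκ2 i) (le_refl |p i - c|) (abs_nonneg _) zero_le_two
        have habs := mul_le_mul_of_nonneg_left (le_abs_self (p i - c)) (hκ0 i)
        linarith
    _ = s.card * c + 2 * ∑ i ∈ s, |p i - c| := by
        rw [Finset.sum_add_distrib, ← Finset.sum_mul, hκ, Finset.mul_sum]
    _ ≤ s.card * (c + 2 * √(v - c ^ 2)) := by linarith

/-- The mean of `‖∑ ω^l a_l‖²`, `l < N`, over the `(N+1)`-th roots of unity `ω`. Using one root more
than there are coefficients makes `ω⁻¹` orthogonal to the polynomial. -/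
noncomputable def rootMean (N : ℕ) (a : ℕ → Z) : ℝ :=
  (∑ i ∈ Finset.range (N + 1), ‖∑ l ∈ Finset.range N,
    (Complex.exp (2 * Real.pi * Complex.I / (N + 1 : ℕ)) ^ i) ^ l • a l‖ ^ 2) / (N + 1 : ℕ)

theorem mul_norm_coeff_le_sum_norm {N k : ℕ} {ω : ℂ} (hω : IsPrimitiveRoot ω (N + 1)) (a : ℕ → Z)
    (hk : k < N) :
    (N + 1 : ℕ) * ‖a k‖
      ≤ ∑ i ∈ Finset.range (N + 1), ‖∑ l ∈ Finset.range N, (ω ^ i) ^ l • a l‖ := by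
  have hnorm := norm_sum_le (Finset.range (N + 1))
    fun i => (ω ^ i) ^ (N + 1 - k) • ∑ l ∈ Finset.range N, (ω ^ i) ^ l • a l
  rw [sum_pow_smul_polynomial_eq_coeff hω a N.le_succ hk (by rw [Nat.sub_add_cancel (by omega)]),
    norm_smul, Complex.norm_natCast] at hnorm
  simpa only [norm_smul, norm_pow, hω.norm'_eq_one N.succ_ne_zero, one_pow, one_mul] using hnorm

theorem sq_norm_coeff_le_rootMean {N k : ℕ} (a : ℕ → Z) (hk : k < N) :
    ‖a k‖ ^ 2 ≤ rootMean N a := by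
  have hω := Complex.isPrimitiveRoot_exp (N + 1) N.succ_ne_zero
  rw [rootMean, le_div_iff₀ (by positivity)]
  have hcauchy := (pow_le_pow_left₀ (by positivity) (mul_norm_coeff_le_sum_norm hω a hk) 2).trans
    sq_sum_le_card_mul_sum_sq
  rw [Finset.card_range, mul_pow, sq ((N + 1 : ℕ) : ℝ), mul_assoc, mul_comm _ (‖a k‖ ^ 2)]
    at hcauchy
  exact le_of_mul_le_mul_left hcauchy (by positivity)

theorem sq_norm_add_sq_norm_le_rootMean {N k : ℕ} (a : ℕ → Z) {φ : StrongDual ℂ Z} (hφ : ‖φ‖ ≤ 1)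
    (hk : 1 ≤ k) (hkN : k < N) : ‖φ (a 0)‖ ^ 2 + ‖φ (a k)‖ ^ 2 ≤ rootMean N a := by
  have hω := Complex.isPrimitiveRoot_exp (N + 1) N.succ_ne_zero
  have hparseval := sum_sq_norm_polynomial hω N.le_succ fun l => φ (a l)
  rw [rootMean, le_div_iff₀ (by positivity), mul_comm]
  calc (N + 1 : ℕ) * (‖φ (a 0)‖ ^ 2 + ‖φ (a k)‖ ^ 2)
      = (N + 1 : ℕ) * ∑ l ∈ {0, k}, ‖φ (a l)‖ ^ 2 := by
        rw [Finset.sum_pair (by omega)]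
    _ ≤ (N + 1 : ℕ) * ∑ l ∈ Finset.range N, ‖φ (a l)‖ ^ 2 := by
        gcongr
        intro l hl
        rw [Finset.mem_insert, Finset.mem_singleton] at hl
        exact Finset.mem_range.2 (by omega)
    _ ≤ _ := by
        rw [← hparseval]
        gcongr with i _
        simp_rw [← map_smul, ← map_sum]
        exact φ.le_of_opNorm_le hφ _ |>.trans_eq (one_mul _)

/-- The Fejér type kernel `1 + Re (ζ ω̄)` is nonnegative, and integrating a polynomial against it
extracts `a 0 + (ζ / 2) • a 1`. -/
noncomputable def fejerKernel (ζ ω : ℂ) : ℝ :=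
  1 + (ζ * (starRingEnd ℂ) ω).re

theorem fejerKernel_mem_Icc {ζ ω : ℂ} (hζ : ‖ζ‖ ≤ 1) (hω : ‖ω‖ = 1) :
    fejerKernel ζ ω ∈ Set.Icc 0 2 := by
  have h : |(ζ * (starRingEnd ℂ) ω).re| ≤ 1 := (Complex.abs_re_le_norm _).trans (by simpa [hω])
  rw [abs_le] at h
  constructor <;> unfold fejerKernel <;> linarith

theorem ofReal_fejerKernel {N : ℕ} {z : ℂ} (ζ : ℂ) (hN : 1 ≤ N) (hz : z ^ (N + 1) = 1) :
    (fejerKernel ζ z : ℂ) = 1 + ζ / 2 * z ^ N + (starRingEnd ℂ) ζ / 2 * z := by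
  have hconj := conj_pow_eq_pow_sub (k := 1) (by omega) hz
  rw [pow_one, Nat.add_sub_cancel] at hconj
  rw [fejerKernel, ← hconj]
  push_cast
  rw [Complex.re_eq_add_conj]
  simp only [map_mul, Complex.conj_conj]
  ring

theorem sum_fejerKernel_smul_polynomial {N : ℕ} (hN : 2 ≤ N) {ω : ℂ}
    (hω : IsPrimitiveRoot ω (N + 1)) (a : ℕ → Z) (ζ : ℂ) :
    ∑ i ∈ Finset.range (N + 1), (fejerKernel ζ (ω ^ i) : ℂ) •
        ∑ l ∈ Finset.range N, (ω ^ i) ^ l • a l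
      = ((N + 1 : ℕ) : ℂ) • (a 0 + (ζ / 2) • a 1) := by
  have h0 := sum_pow_smul_polynomial_eq_coeff hω a N.le_succ (k := 0) (m := 0) (by omega) (by simp)
  have h1 := sum_pow_smul_polynomial_eq_coeff hω a N.le_succ (k := 1) (m := N) (by omega) dvd_rfl
  have h2 : ∑ i ∈ Finset.range (N + 1), (ω ^ i) ^ 1 • ∑ l ∈ Finset.range N, (ω ^ i) ^ l • a l
      = 0 := by
    rw [sum_pow_smul_polynomial hω]
    refine Finset.sum_eq_zero fun l hl => ?_
    have hlN := Finset.mem_range.1 hl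
    rw [if_neg (Nat.not_dvd_of_pos_of_lt (by omega) (by omega)), zero_smul]
  simp only [pow_zero, one_smul, pow_one] at h0 h2
  have hroot : ∀ i, (ω ^ i) ^ (N + 1) = 1 := fun i => by
    rw [pow_right_comm, hω.pow_eq_one, one_pow]
  simp_rw [ofReal_fejerKernel ζ (by omega : 1 ≤ N) (hroot _), add_smul, Finset.sum_add_distrib,
    mul_smul, one_smul, ← Finset.smul_sum]
  rw [h0, h1, h2, smul_zero, add_zero, smul_add, smul_comm (ζ / 2)]

theorem sum_fejerKernel {N : ℕ} (hN : 2 ≤ N) {ω : ℂ} (hω : IsPrimitiveRoot ω (N + 1)) (ζ : ℂ) :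
    ∑ i ∈ Finset.range (N + 1), fejerKernel ζ (ω ^ i) = (N + 1 : ℕ) := by
  have h := sum_fejerKernel_smul_polynomial hN hω (Pi.single 0 (1 : ℂ)) ζ
  have hpoly : ∀ i, ∑ l ∈ Finset.range N, (ω ^ i) ^ l • (Pi.single 0 1 : ℕ → ℂ) l = 1 := fun i => by
    rw [Finset.sum_eq_single_of_mem 0 (Finset.mem_range.2 (by omega)) (by simp_all)]
    simp
  simp only [hpoly] at h
  simp only [smul_eq_mul, mul_one, Pi.single_eq_same, ne_eq, one_ne_zero, not_false_eq_true,
    Pi.single_eq_of_ne, mul_zero, add_zero] at h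
  exact_mod_cast h

theorem norm_coeff_zero_add_le {N : ℕ} (hN : 2 ≤ N) (a : ℕ → Z) {ζ : ℂ} (hζ : ‖ζ‖ ≤ 1) :
    ‖a 0 + (ζ / 2) • a 1‖ ≤ ‖a 0‖ + 2 * √(rootMean N a - ‖a 0‖ ^ 2) := by
  have hω := Complex.isPrimitiveRoot_exp (N + 1) N.succ_ne_zero
  set ω := Complex.exp (2 * Real.pi * Complex.I / (N + 1 : ℕ))
  have hκ : ∀ i, fejerKernel ζ (ω ^ i) ∈ Set.Icc 0 2 := fun i =>
    fejerKernel_mem_Icc hζ (by rw [norm_pow, hω.norm'_eq_one N.succ_ne_zero, one_pow])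
  have hmean := sum_mul_le_of_sum_sq_eq (s := Finset.range (N + 1)) (c := ‖a 0‖)
    (κ := fun i => fejerKernel ζ (ω ^ i)) (v := rootMean N a)
    (p := fun i => ‖∑ l ∈ Finset.range N, (ω ^ i) ^ l • a l‖) (fun i => (hκ i).1)
    (fun i => (hκ i).2) (by rw [sum_fejerKernel hN hω, Finset.card_range]) (norm_nonneg _)
    (by rw [Finset.card_range]; exact mul_norm_coeff_le_sum_norm hω a (by omega))
    (by rw [Finset.card_range, rootMean, mul_div_cancel₀ _ (by positivity)])
  rw [Finset.card_range] at hmean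
  have hpos : (0 : ℝ) < (N + 1 : ℕ) := by positivity
  refine le_of_mul_le_mul_left ?_ hpos
  calc (N + 1 : ℕ) * ‖a 0 + (ζ / 2) • a 1‖
      = ‖∑ i ∈ Finset.range (N + 1), (fejerKernel ζ (ω ^ i) : ℂ) •
          ∑ l ∈ Finset.range N, (ω ^ i) ^ l • a l‖ := by
        rw [sum_fejerKernel_smul_polynomial hN hω, norm_smul, Complex.norm_natCast]
    _ ≤ _ := norm_sum_le_of_le _ fun i _ => by
        rw [norm_smul, Complex.norm_real, Real.norm_of_nonneg (hκ i).1]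
    _ ≤ _ := hmean

end RootsOfUnity

/-! ### Almost extremal vectors of a plateau -/

section Plateau

variable {J Y Z : Type*} [NormedAddCommGroup Y] [NormedSpace ℂ Y] [NormedAddCommGroup Z]
    [NormedSpace ℂ Z]

/-- `B` is a right inverse of `A`, and `A - μ` is bounded below by `σ` for all `μ` in the disc
`|μ| ≤ r`. The vectors `y` with `‖A y‖` close to `σ ‖y‖` witness that the lower bound does not
improve at the centre of the disc. -/
structure IsBoundedBelowOnDisc (σ r : ℝ) (A B : Y →L[ℂ] Y) : Prop where
  mul_eq_one : A * B = 1
  mul_norm_le : ∀ μ : ℂ, ‖μ‖ ≤ r → ∀ y, σ * ‖y‖ ≤ ‖(A - μ • 1) y‖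

namespace IsBoundedBelowOnDisc

variable {σ r : ℝ} {A B : Y →L[ℂ] Y}

theorem mono (h : IsBoundedBelowOnDisc σ r A B) {r' : ℝ} (hr : r' ≤ r) :
    IsBoundedBelowOnDisc σ r' A B :=
  ⟨h.mul_eq_one, fun μ hμ => h.mul_norm_le μ (hμ.trans hr)⟩

theorem apply_apply (h : IsBoundedBelowOnDisc σ r A B) (y : Y) : A (B y) = y :=
  DFunLike.congr_fun h.mul_eq_one y

theorem mul_norm_le_norm_apply (h : IsBoundedBelowOnDisc σ r A B) (hr : 0 ≤ r) (y : Y) :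
    σ * ‖y‖ ≤ ‖A y‖ := by
  simpa using h.mul_norm_le 0 (by simpa using hr) y

theorem pow_mul_norm_pow_le (h : IsBoundedBelowOnDisc σ r A B) (hσ : 0 ≤ σ) (hr : 0 ≤ r) (k : ℕ)
    (y : Y) : σ ^ k * ‖(B ^ k) y‖ ≤ ‖y‖ := by
  induction k with
  | zero => simp
  | succ k ih =>
    calc σ ^ (k + 1) * ‖(B ^ (k + 1)) y‖ = σ ^ k * (σ * ‖B ((B ^ k) y)‖) := by
          rw [pow_succ, mul_assoc, pow_succ' B]
          rfl
      _ ≤ σ ^ k * ‖A (B ((B ^ k) y))‖ := by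
          gcongr
          exact h.mul_norm_le_norm_apply hr _
      _ ≤ ‖y‖ := by rwa [h.apply_apply]

theorem sub_smul_apply_orbit_sum (h : IsBoundedBelowOnDisc σ r A B) (w : ℂ) (y : Y) (N : ℕ) :
    (A - w • 1) (∑ l ∈ Finset.range (N + 1), w ^ l • (B ^ l) y)
      = A y - w ^ (N + 1) • (B ^ N) y := by
  induction N with
  | zero => simp
  | succ N ih =>
    have hA : A ((B ^ (N + 1)) y) = (B ^ N) y := by
      rw [pow_succ' B]
      exact h.apply_apply _
    rw [Finset.sum_range_succ, map_add, ih, map_smul, sub_apply, hA]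
    simp only [_root_.smul_apply, one_apply_eq_self, smul_sub, smul_smul, ← pow_succ]
    abel

theorem mul_norm_orbit_sum_le (h : IsBoundedBelowOnDisc σ r A B) (hσ : 0 < σ) (hr : 0 ≤ r)
    (hrσ : 2 * r ≤ σ) {w : ℂ} (hw : ‖w‖ = r) (y : Y) {N : ℕ} (hN : 0 < N) :
    σ * ‖∑ l ∈ Finset.range N, w ^ l • (B ^ l) y‖ ≤ ‖A y‖ + σ * (1 / 2) ^ N * ‖y‖ := by
  obtain ⟨N, rfl⟩ := Nat.exists_eq_add_one.2 hN
  have htail : ‖w ^ (N + 1) • (B ^ N) y‖ ≤ σ * (1 / 2) ^ (N + 1) * ‖y‖ := by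
    rw [norm_smul, norm_pow, hw]
    calc r ^ (N + 1) * ‖(B ^ N) y‖ ≤ (σ * (1 / 2)) ^ (N + 1) * ‖(B ^ N) y‖ := by
          gcongr
          linarith
      _ = σ * (1 / 2) ^ (N + 1) * (σ ^ N * ‖(B ^ N) y‖) := by ring
      _ ≤ _ := by
          gcongr
          exact h.pow_mul_norm_pow_le hσ.le hr N y
  refine (h.mul_norm_le w hw.le _).trans ?_
  rw [h.sub_smul_apply_orbit_sum]
  exact (norm_sub_le _ _).trans (by gcongr)

theorem exists_hasSum_rootMean (h : IsBoundedBelowOnDisc σ r A B) {T : J → Y →L[ℂ] Z}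
    (hT : IsL2Coord T) (hσ : 0 < σ) (hr : 0 ≤ r) (hrσ : 2 * r ≤ σ) (y : Y) {N : ℕ} (hN : 0 < N) :
    ∃ S ≤ (‖A y‖ / σ + (1 / 2) ^ N * ‖y‖) ^ 2,
      HasSum (fun j => rootMean N fun l => T j ((((r : ℂ) • B) ^ l) y)) S := by
  have hω := (Complex.isPrimitiveRoot_exp (N + 1) N.succ_ne_zero).norm'_eq_one N.succ_ne_zero
  set ω := Complex.exp (2 * Real.pi * Complex.I / (N + 1 : ℕ))
  set P : ℕ → Y := fun i => ∑ l ∈ Finset.range N, (ω ^ i) ^ l • (((r : ℂ) • B) ^ l) y with hP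
  have hPle : ∀ i, ‖P i‖ ≤ ‖A y‖ / σ + (1 / 2) ^ N * ‖y‖ := fun i => by
    have hPi : P i = ∑ l ∈ Finset.range N, (ω ^ i * r) ^ l • (B ^ l) y :=
      Finset.sum_congr rfl fun l _ => by rw [smul_pow, _root_.smul_apply, smul_smul, mul_pow]
    have hle := h.mul_norm_orbit_sum_le hσ hr hrσ (w := ω ^ i * r)
      (by simp [hω, abs_of_nonneg hr]) y hN
    rwa [← hPi, mul_assoc, ← le_div_iff₀' hσ, add_div, mul_div_cancel_left₀ _ hσ.ne'] at hle
  refine ⟨(∑ i ∈ Finset.range (N + 1), ‖P i‖ ^ 2) / (N + 1 : ℕ), ?_, ?_⟩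
  · rw [div_le_iff₀ (by positivity), mul_comm, ← nsmul_eq_mul]
    nth_rw 2 [← Finset.card_range (N + 1)]
    exact Finset.sum_le_card_nsmul _ _ _ fun i _ => pow_le_pow_left₀ (norm_nonneg _) (hPle i) 2
  · have hsum : HasSum (fun j => (∑ i ∈ Finset.range (N + 1), ‖T j (P i)‖ ^ 2) / (N + 1 : ℕ))
        ((∑ i ∈ Finset.range (N + 1), ‖P i‖ ^ 2) / (N + 1 : ℕ)) :=
      (hasSum_sum fun i _ => hT (P i)).div_const _
    simpa only [rootMean, hP, map_sum, map_smul] using hsum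

end IsBoundedBelowOnDisc

theorem exists_hasSum_rootMean_sub_sq_norm {T : J → Y →L[ℂ] Z} (hT : IsL2Coord T) {σ r τ : ℝ}
    (hσ : 0 < σ) (hr : 0 ≤ r) (hrσ : 2 * r ≤ σ) (hτ : 0 < τ) (N₀ : ℕ) :
    ∃ N, N₀ ≤ N ∧ ∃ δ : ℝ, 0 < δ ∧ ∀ A B : Y →L[ℂ] Y, IsBoundedBelowOnDisc σ r A B →
      ∀ y, ‖A y‖ < (σ + δ) * ‖y‖ → ∃ S ≤ τ * ‖y‖ ^ 2,
        HasSum (fun j => rootMean N (fun l => T j ((((r : ℂ) • B) ^ l) y)) - ‖T j y‖ ^ 2) S := by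
  obtain ⟨κ, hκ, hκτ⟩ : ∃ κ : ℝ, 0 < κ ∧ (1 + κ + κ) ^ 2 - 1 ≤ τ := by
    refine ⟨min 1 (τ / 8), by positivity, ?_⟩
    nlinarith [min_le_left 1 (τ / 8), min_le_right 1 (τ / 8),
      lt_min one_pos (by positivity : 0 < τ / 8)]
  obtain ⟨N₁, hN₁⟩ := exists_pow_lt_of_lt_one hκ (by norm_num : (1 / 2 : ℝ) < 1)
  refine ⟨N₀ + N₁ + 1, by omega, σ * κ, by positivity, fun A B h y hy => ?_⟩
  obtain ⟨S, hS, hsum⟩ := h.exists_hasSum_rootMean hT hσ hr hrσ y (N₀ + N₁).succ_pos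
  refine ⟨S - ‖y‖ ^ 2, ?_, hsum.sub (hT y)⟩
  have hpow : (1 / 2 : ℝ) ^ (N₀ + N₁ + 1) ≤ κ :=
    (pow_le_pow_of_le_one (by norm_num) (by norm_num) (by omega)).trans hN₁.le
  have hAy : ‖A y‖ / σ ≤ (1 + κ) * ‖y‖ := by
    rw [div_le_iff₀ hσ]
    linarith
  have hSle : S ≤ ((1 + κ + κ) * ‖y‖) ^ 2 := by
    refine hS.trans (pow_le_pow_left₀ (by positivity) ?_ 2)
    rw [add_mul]
    gcongr
  nlinarith [mul_le_mul_of_nonneg_right hκτ (sq_nonneg ‖y‖)]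

end Plateau

/-! ### Complex uniform convexity -/

section ComplexUniformConvexity

variable {J Y Z : Type*} [NormedAddCommGroup Y] [NormedSpace ℂ Y] [NormedAddCommGroup Z]
    [NormedSpace ℂ Z]

theorem mul_norm_coeff_zero_le_or_norm_coeff_one_lt {η δ : ℝ} (hδ : 0 ≤ δ)
    (h : ∀ x y : Z, η ≤ ‖y‖ → (∀ ζ : ℂ, ‖ζ‖ ≤ 1 → ‖x + ζ • y‖ ≤ 1) → ‖x‖ ≤ 1 - δ)
    {N : ℕ} (hN : 2 ≤ N) (a : ℕ → Z) :
    δ * ‖a 0‖ ≤ 2 * √(rootMean N a - ‖a 0‖ ^ 2) ∨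
      ‖a 1‖ < 2 * η * (‖a 0‖ + 2 * √(rootMean N a - ‖a 0‖ ^ 2)) := by
  set e := √(rootMean N a - ‖a 0‖ ^ 2)
  have he : 0 ≤ e := Real.sqrt_nonneg _
  rcases (norm_nonneg (a 0)).eq_or_lt with ha | ha
  · left
    rw [← ha, mul_zero]
    positivity
  have hρ : 0 < ‖a 0‖ + 2 * e := by positivity
  set ρ := ‖a 0‖ + 2 * e
  have hnorm : ∀ x : Z, ‖(ρ⁻¹ : ℂ) • x‖ = ‖x‖ / ρ := fun x => by
    rw [norm_smul, norm_inv, Complex.norm_real, Real.norm_of_nonneg hρ.le, inv_mul_eq_div]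
  rcases le_or_gt η ‖(ρ⁻¹ : ℂ) • (1 / 2 : ℂ) • a 1‖ with hη | hη
  · left
    have hconv := h ((ρ⁻¹ : ℂ) • a 0) _ hη fun ζ hζ => by
      rw [smul_comm ζ, ← smul_add, hnorm, div_le_one hρ, smul_smul, mul_one_div]
      exact norm_coeff_zero_add_le hN a hζ
    rw [hnorm, div_le_iff₀ hρ] at hconv
    nlinarith
  · right
    rw [hnorm, norm_smul, div_lt_iff₀ hρ] at hη
    norm_num at hη
    linarith

/-- In a complex uniformly convex space, if the mean of `‖a 0 + ω • a 1 + ⋯‖²` is close to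
`‖a 0‖²` then `a 1` is small. -/
theorem ComplexUniformlyConvex.exists_sq_norm_coeff_one_le (hZ : ComplexUniformlyConvex Z) {θ : ℝ}
    (hθ : 0 < θ) :
    ∃ C : ℝ, 0 ≤ C ∧ ∀ N, 2 ≤ N → ∀ a : ℕ → Z,
      ‖a 1‖ ^ 2 ≤ θ * ‖a 0‖ ^ 2 + C * (rootMean N a - ‖a 0‖ ^ 2) := by
  obtain ⟨η, hη, hηθ⟩ : ∃ η : ℝ, 0 < η ∧ 8 * η ^ 2 = θ :=
    ⟨√(θ / 8), by positivity, by rw [Real.sq_sqrt (by positivity)]; ring⟩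
  obtain ⟨δ, hδ, hconv⟩ := hZ η hη
  refine ⟨4 * θ + 4 / δ ^ 2 + 1, by positivity, fun N hN a => ?_⟩
  have he : 0 ≤ rootMean N a - ‖a 0‖ ^ 2 := sub_nonneg.2 (sq_norm_coeff_le_rootMean a (by omega))
  have ha1 : ‖a 1‖ ^ 2 ≤ ‖a 0‖ ^ 2 + (rootMean N a - ‖a 0‖ ^ 2) := by
    rw [add_sub_cancel]
    exact sq_norm_coeff_le_rootMean a (by omega)
  have hsq := Real.sq_sqrt he
  set e := rootMean N a - ‖a 0‖ ^ 2
  have hexpand : (4 * θ + 4 / δ ^ 2 + 1) * e = 4 * θ * e + 4 * e / δ ^ 2 + e := by ring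
  have hθe : 0 ≤ 4 * θ * e := by positivity
  have hδe : 0 ≤ 4 * e / δ ^ 2 := by positivity
  rcases mul_norm_coeff_zero_le_or_norm_coeff_one_lt hδ.le hconv hN a with h | h
  · have ha0 : ‖a 0‖ ^ 2 ≤ 4 * e / δ ^ 2 := by
      rw [le_div_iff₀ (by positivity), ← mul_pow, mul_comm]
      exact (pow_le_pow_left₀ (by positivity) h 2).trans_eq (by rw [mul_pow, hsq]; norm_num)
    have : 0 ≤ θ * ‖a 0‖ ^ 2 := by positivity
    linarith
  · calc ‖a 1‖ ^ 2 ≤ (2 * η * (‖a 0‖ + 2 * √e)) ^ 2 := by gcongr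
      _ = 4 * η ^ 2 * (‖a 0‖ + 2 * √e) ^ 2 := by ring
      _ ≤ 4 * η ^ 2 * (2 * (‖a 0‖ ^ 2 + (2 * √e) ^ 2)) := by
          gcongr
          exact add_sq_le
      _ = θ * ‖a 0‖ ^ 2 + 4 * θ * e := by rw [← hηθ, mul_pow, hsq]; ring
      _ ≤ _ := by linarith

/-- A uniform version of Globevnik's theorem that the resolvent norm of an operator on a complex
uniformly convex space is nowhere locally constant. -/
theorem ComplexUniformlyConvex.exists_add_mul_norm_le (hZ : ComplexUniformlyConvex Z)
    {T : J → Y →L[ℂ] Z} (hT : IsL2Coord T) {σ r : ℝ} (hσ : 0 < σ) (hr : 0 < r) (K : ℝ) :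
    ∃ δ : ℝ, 0 < δ ∧ ∀ A B : Y →L[ℂ] Y, ‖A‖ ≤ K → IsBoundedBelowOnDisc σ r A B →
      ∀ y, (σ + δ) * ‖y‖ ≤ ‖A y‖ := by
  wlog hrσ : 2 * r ≤ σ generalizing r
  · obtain ⟨δ, hδ, h⟩ := this (r := σ / 2) (by positivity) (by linarith)
    exact ⟨δ, hδ, fun A B hA hAB => h A B hA (hAB.mono (by linarith))⟩
  wlog hK : 0 < K generalizing K
  · obtain ⟨δ, hδ, h⟩ := this 1 one_pos
    exact ⟨δ, hδ, fun A B hA hAB => h A B (by linarith) hAB⟩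
  have hL : 0 < (r / K) ^ 2 := by positivity
  set L := (r / K) ^ 2
  obtain ⟨C, hC, hcoeff⟩ := hZ.exists_sq_norm_coeff_one_le (half_pos hL)
  obtain ⟨τ, hτ, hCτ⟩ : ∃ τ : ℝ, 0 < τ ∧ C * τ < L / 2 :=
    ⟨L / 2 / (C + 1), by positivity, by
      rw [← mul_div_assoc, div_lt_iff₀ (by positivity)]
      linarith⟩
  obtain ⟨N, hN, δ, hδ, hmean⟩ := exists_hasSum_rootMean_sub_sq_norm hT hσ hr.le hrσ hτ 2
  refine ⟨δ, hδ, fun A B hA hAB y => ?_⟩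
  by_contra! hy
  have hy0 : 0 < ‖y‖ := by
    refine norm_pos_iff.2 fun h0 => ?_
    simp [h0] at hy
  obtain ⟨S, hS, hsum⟩ := hmean A B hAB y hy
  have hupper : ‖(r : ℂ) • B y‖ ^ 2 ≤ L / 2 * ‖y‖ ^ 2 + C * S := by
    refine hasSum_le (fun j => ?_) (hT _) (((hT y).mul_left _).add (hsum.mul_left C))
    simpa using hcoeff N hN fun l => T j ((((r : ℂ) • B) ^ l) y)
  have hlower : L * ‖y‖ ^ 2 ≤ ‖(r : ℂ) • B y‖ ^ 2 := by
    have hBy : ‖y‖ ≤ K * ‖B y‖ := by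
      simpa only [hAB.apply_apply] using A.le_of_opNorm_le hA (B y)
    rw [norm_smul, Complex.norm_real, Real.norm_of_nonneg hr.le, ← mul_pow]
    refine pow_le_pow_left₀ (by positivity) ?_ 2
    rw [div_mul_eq_mul_div, div_le_iff₀ hK, mul_assoc, mul_comm _ K]
    gcongr
  have hCS : C * S ≤ C * τ * ‖y‖ ^ 2 := by
    rw [mul_assoc]
    gcongr
  have hlt : C * τ * ‖y‖ ^ 2 < L / 2 * ‖y‖ ^ 2 := by gcongr
  linarith

end ComplexUniformConvexity

/-! ### Locally shift-invariant families of sequence spaces -/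

section ShiftInvariance

variable {K : Type*} [Field K]

/-- The right shift `(f₀, f₁, …) ↦ (0, f₀, f₁, …)` on sequences. -/
noncomputable def rightShift (K : Type*) [Field K] : (ℕ → K) →ₗ[K] (ℕ → K) :=
  Function.ExtendByZero.linearMap K Nat.succ

theorem rightShift_single (k : ℕ) :
    rightShift K (Pi.single k 1) = Pi.single (k + 1) 1 := by
  ext (_ | i)
  · simp [rightShift, Function.extend_apply']
  · simp [rightShift, Nat.succ_injective.extend_apply, Pi.single_apply]

theorem le_finrank_of_single_mem {U : Submodule K (ℕ → K)} [FiniteDimensional K U] {w : ℕ}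
    (h : ∀ k < w, (Pi.single k 1 : ℕ → K) ∈ U) : w ≤ Module.finrank K U := by
  have hindep : LinearIndependent K (fun k : Fin w => (⟨Pi.single (k : ℕ) 1, h k k.2⟩ : U)) :=
    .of_comp U.subtype ((Pi.linearIndependent_single_one ℕ K).comp _ Fin.val_injective)
  simpa using hindep.fintype_card_le_finrank

theorem not_map_rightShift_le {U : Submodule K (ℕ → K)} [FiniteDimensional K U]
    (h0 : (Pi.single 0 1 : ℕ → K) ∈ U) : ¬ U.map (rightShift K) ≤ U := fun h => by
  have hmem : ∀ k, (Pi.single k 1 : ℕ → K) ∈ U := fun k => by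
    induction k with
    | zero => exact h0
    | succ k ih =>
      rw [← rightShift_single]
      exact h (Submodule.mem_map_of_mem ih)
  have := le_finrank_of_single_mem (U := U) (w := Module.finrank K U + 1) fun k _ => hmem k
  omega

section Windows

variable {G : ℕ → Submodule K (ℕ → K)} (h0 : ∀ n, (Pi.single 0 1 : ℕ → K) ∈ G n)
  (hG : ∀ n, (G (n + 1)).map (rightShift K) ≤ G n ⊔ G (n + 1) ⊔ G (n + 2))

include h0 hG

theorem single_mem_sup_Ico (k a : ℕ) :
    (Pi.single k 1 : ℕ → K) ∈ (Finset.Ico a (a + 2 * k + 1)).sup G := by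
  induction k generalizing a with
  | zero => simpa using h0 a
  | succ k ih =>
    rw [← rightShift_single]
    suffices h : ((Finset.Ico (a + 1) (a + 1 + 2 * k + 1)).sup G).map (rightShift K)
        ≤ (Finset.Ico a (a + 2 * (k + 1) + 1)).sup G from h (Submodule.mem_map_of_mem (ih (a + 1)))
    rw [Submodule.map_le_iff_le_comap]
    refine Finset.sup_le fun i hi => ?_
    rw [Finset.mem_Ico] at hi
    obtain ⟨n, rfl⟩ : ∃ n, i = n + 1 := ⟨i - 1, by omega⟩
    rw [← Submodule.map_le_iff_le_comap]
    refine (hG n).trans (sup_le (sup_le ?_ ?_) ?_) <;>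
      exact Finset.le_sup (Finset.mem_Ico.2 (by omega))

-- Both halves of a window contain the first half of the unit sequences of their length.
theorem finrank_sup_Ico_add_le [∀ n, FiniteDimensional K (G n)] (a w : ℕ) :
    Module.finrank K ↥((Finset.Ico a (a + 2 * w)).sup G) + (w + 1) / 2
      ≤ Module.finrank K ↥((Finset.Ico a (a + w)).sup G)
        + Module.finrank K ↥((Finset.Ico (a + w) (a + w + w)).sup G) := by
  have hmem : ∀ b, ∀ k < (w + 1) / 2,
      (Pi.single k 1 : ℕ → K) ∈ (Finset.Ico b (b + w)).sup G := fun b k hk =>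
    have hsub : Finset.Ico b (b + 2 * k + 1) ⊆ Finset.Ico b (b + w) :=
      Finset.Ico_subset_Ico le_rfl (by omega)
    Finset.sup_mono (f := G) hsub (single_mem_sup_Ico h0 hG k b)
  rw [show a + 2 * w = a + w + w by ring, ← Finset.Ico_union_Ico_eq_Ico (show a ≤ a + w by omega)
    (show a + w ≤ a + w + w by omega), Finset.sup_union, ← Submodule.finrank_sup_add_finrank_inf_eq]
  have := Submodule.finiteDimensional_finset_sup (Finset.Ico a (a + w)) G
  have := Submodule.finiteDimensional_finset_sup (Finset.Ico (a + w) (a + w + w)) G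
  gcongr
  exact le_finrank_of_single_mem fun k hk => ⟨hmem a k hk, hmem (a + w) k hk⟩

theorem finrank_sup_Ico_two_pow_le [∀ n, FiniteDimensional K (G n)] {m : ℕ}
    (hm : ∀ n, Module.finrank K (G n) ≤ m) (l a : ℕ) :
    4 * Module.finrank K ↥((Finset.Ico a (a + 2 ^ l)).sup G) + l * 2 ^ l ≤ 4 * m * 2 ^ l := by
  induction l generalizing a with
  | zero =>
    rw [pow_zero, Nat.Ico_succ_singleton, Finset.sup_singleton]
    simpa using hm a
  | succ l ih =>
    have hsplit := finrank_sup_Ico_add_le h0 hG a (2 ^ l)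
    have hleft := ih a
    have hright := ih (a + 2 ^ l)
    rw [show (l + 1) * 2 ^ (l + 1) = 2 * (l * 2 ^ l) + 2 * 2 ^ l by ring,
      show 4 * m * 2 ^ (l + 1) = 2 * (4 * m * 2 ^ l) by ring, pow_succ' 2 l]
    omega

theorem not_forall_finrank_le [∀ n, FiniteDimensional K (G n)] (m : ℕ) :
    ¬ ∀ n, Module.finrank K (G n) ≤ m := fun hm => by
  have hle := finrank_sup_Ico_two_pow_le h0 hG hm (4 * m + 1) 0
  have hlt : 4 * m * 2 ^ (4 * m + 1) < (4 * m + 1) * 2 ^ (4 * m + 1) := by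
    gcongr
    omega
  omega

end Windows

variable {F : ℤ → Submodule K (ℕ → K)} [∀ j, FiniteDimensional K (F j)] {m : ℕ}

theorem exists_nat_eq_bot (hm : ∀ j, Module.finrank K (F j) ≤ m)
    (h0 : ∀ j, F j = ⊥ ∨ Pi.single 0 1 ∈ F j)
    (hF : ∀ j, (F j).map (rightShift K)
      ≤ F (j - 1) ⊔ F j ⊔ F (j + 1) ⊔ Submodule.span K {Pi.single 0 1}) :
    ∃ n : ℕ, F n = ⊥ := by
  by_contra! hne
  have hmem : ∀ n : ℕ, (Pi.single 0 1 : ℕ → K) ∈ F n := fun n => (h0 n).resolve_left (hne n)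
  refine not_forall_finrank_le (G := fun n : ℕ => F n) hmem (fun n => ?_) m fun n => hm n
  have hle := hF ((n + 1 : ℕ) : ℤ)
  rw [show ((n + 1 : ℕ) : ℤ) - 1 = n by push_cast; ring,
    show ((n + 1 : ℕ) : ℤ) + 1 = ((n + 2 : ℕ) : ℤ) by push_cast; ring] at hle
  exact hle.trans (sup_le le_rfl (le_sup_of_le_left (le_sup_of_le_right
    ((Submodule.span_singleton_le_iff_mem _ _).2 (hmem (n + 1))))))

/-- The dimensions cannot stay bounded: on an infinite run of non-trivial `F j` the dimension of
a window of length `2 ^ l` would be smaller than `0` for large `l`, and on a finite run, the sum of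
all `F j` would be a finite-dimensional shift-invariant space. -/
theorem eq_bot_of_map_rightShift_le (hm : ∀ j, Module.finrank K (F j) ≤ m)
    (h0 : ∀ j, F j = ⊥ ∨ Pi.single 0 1 ∈ F j)
    (hF : ∀ j, (F j).map (rightShift K)
      ≤ F (j - 1) ⊔ F j ⊔ F (j + 1) ⊔ Submodule.span K {Pi.single 0 1}) :
    F 0 = ⊥ := by
  obtain ⟨b, hb⟩ := exists_nat_eq_bot hm h0 hF
  obtain ⟨a, ha⟩ := exists_nat_eq_bot (F := fun j => F (-j)) (fun j => hm (-j)) (fun j => h0 (-j))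
    fun j => (hF (-j)).trans_eq (by
      simp only [neg_add, sub_eq_add_neg, neg_neg, sup_assoc, sup_comm, sup_left_comm])
  refine (h0 0).resolve_right fun h00 => ?_
  set U := (Finset.Icc (-a : ℤ) b).sup F
  have hle : ∀ j : ℤ, -a ≤ j → j ≤ b → F j ≤ U := fun j hj hj' =>
    Finset.le_sup (Finset.mem_Icc.2 ⟨hj, hj'⟩)
  have : FiniteDimensional K U := Submodule.finiteDimensional_finset_sup _ _
  have hU0 : (Pi.single 0 1 : ℕ → K) ∈ U := hle 0 (by omega) (by omega) h00
  refine not_map_rightShift_le hU0 ?_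
  rw [Submodule.map_le_iff_le_comap]
  refine Finset.sup_le fun j hj => ?_
  rw [Finset.mem_Icc] at hj
  obtain rfl | rfl | ⟨hja, hjb⟩ : j = -a ∨ j = b ∨ -a < j ∧ j < b := by omega
  · exact ha.trans_le bot_le
  · exact hb.trans_le bot_le
  · rw [← Submodule.map_le_iff_le_comap]
    exact (hF j).trans (sup_le (sup_le (sup_le (hle _ (by omega) (by omega))
      (hle _ (by omega) (by omega))) (hle _ (by omega) (by omega)))
      ((Submodule.span_singleton_le_iff_mem _ _).2 hU0))

end ShiftInvariance

/-! ### Domination by translates -/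

section Domination

theorem exists_forall_translate_mul_lt {G : Type*} [AddCommGroup G] {u h w : G → ℝ}
    (h0 : ∀ j, 0 ≤ h j) (w0 : ∀ i, 0 ≤ w i) {U H W : ℝ} (hu : HasSum u U) (hh : HasSum h H)
    (hw : HasSum w W) (hlt : H * W < U) :
    ∃ p, ∀ i, h (p + i) * w i < u p := by
  have hprod : HasSum (fun x : G × G => h (x.2 + x.1) * w x.1) (H * W) := by
    rw [mul_comm]
    simpa [Function.comp_def, Equiv.prodShear, mul_comm] using
      (Equiv.prodShear (Equiv.refl G) Equiv.addRight).hasSum_iff.2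
        (hw.mul hh (hw.summable.mul_of_nonneg hh.summable w0 h0))
  replace hprod := (Equiv.prodComm G G).hasSum_iff.2 hprod
  have hfiber : ∀ p, Summable fun i => h (p + i) * w i := hprod.summable.prod_factor
  obtain ⟨p, hp⟩ : ∃ p, ∑' i, h (p + i) * w i < u p := by
    by_contra! hle
    exact hlt.not_ge (hasSum_le hle hu (hprod.prod_fiberwise fun p => (hfiber p).hasSum))
  exact ⟨p, fun i => ((hfiber p).le_tsum i fun j _ => mul_nonneg (h0 _) (w0 j)).trans_lt hp⟩

theorem summable_one_half_pow_natAbs : Summable fun i : ℤ => (1 / 2 : ℝ) ^ i.natAbs :=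
  .of_nat_of_neg (by simpa using summable_geometric_two) (by simpa using summable_geometric_two)

/-- A constant `C` such that every summable family `u ≥ 0` on `ℤ` has a term `u p` with
`u (p + i) ≤ C * 2 ^ |i| * u p` for all `i`. -/
noncomputable def dominationConst : ℝ := 4 * ∑' i : ℤ, (1 / 2 : ℝ) ^ i.natAbs

theorem dominationConst_pos : 0 < dominationConst :=
  mul_pos four_pos (summable_one_half_pow_natAbs.tsum_pos (fun _ => by positivity) 0 (by simp))

theorem exists_dominating_index {u e : ℤ → ℝ} (hu0 : ∀ j, 0 ≤ u j) (he0 : ∀ j, 0 ≤ e j)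
    {U E ε : ℝ} (hu : HasSum u U) (he : HasSum e E) (hU : 0 < U) (hε : 0 < ε)
    (hE : dominationConst * E ≤ ε * U) :
    ∃ p, 0 < u p ∧ ∀ i : ℤ, u (p + i) ≤ dominationConst * 2 ^ i.natAbs * u p ∧
      e (p + i) ≤ ε * 2 ^ i.natAbs * u p := by
  have hC := dominationConst_pos
  have hh0 : ∀ j, 0 ≤ u j / dominationConst + e j / ε := fun j =>
    add_nonneg (div_nonneg (hu0 j) hC.le) (div_nonneg (he0 j) hε.le)
  have hlt : (U / dominationConst + E / ε) * ∑' i : ℤ, (1 / 2 : ℝ) ^ i.natAbs < U := by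
    have hE' : E / ε ≤ U / dominationConst := by
      rw [div_le_div_iff₀ hε hC]
      linarith
    calc _ ≤ (U / dominationConst + U / dominationConst) * (dominationConst / 4) := by
          rw [dominationConst, mul_div_cancel_left₀ _ four_ne_zero, ← dominationConst]
          gcongr
      _ = U / 2 := by field_simp; norm_num
      _ < U := half_lt_self hU
  obtain ⟨p, hp⟩ := exists_forall_translate_mul_lt hh0 (fun i => by positivity) hu
    ((hu.div_const _).add (he.div_const ε)) summable_one_half_pow_natAbs.hasSum hlt
  have hsum : ∀ i : ℤ, u (p + i) / dominationConst + e (p + i) / ε < 2 ^ i.natAbs * u p := by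
    intro i
    have hi := hp i
    rwa [one_div, inv_pow, ← div_eq_mul_inv, div_lt_iff₀' (by positivity)] at hi
  refine ⟨p, (hh0 p).trans_lt (by simpa using hsum 0), fun i => ⟨?_, ?_⟩⟩
  · rw [mul_assoc, ← div_le_iff₀' hC]
    linarith [hsum i, div_nonneg (he0 (p + i)) hε.le]
  · rw [mul_assoc, ← div_le_iff₀' hε]
    linarith [hsum i, div_nonneg (hu0 (p + i)) hC.le]

end Domination

/-! ### Tridiagonal matrices of operators -/

section TridiagonalMatrix

variable {Y Z : Type*} [NormedAddCommGroup Y] [NormedSpace ℂ Y] [NormedAddCommGroup Z]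
  [NormedSpace ℂ Z]

/-- A tridiagonal matrix, indexed by the integers, of operators on `Z`. The entries off the diagonal
are numbered by their column, as in the notation `α_j = a_{j+1,j}`, `γ_j = a_{j-1,j}`. -/
structure TridiagonalMatrix (Z : Type*) [NormedAddCommGroup Z] [NormedSpace ℂ Z] where
  lower : ℤ → Z →L[ℂ] Z
  diag : ℤ → Z →L[ℂ] Z
  upper : ℤ → Z →L[ℂ] Z

namespace TridiagonalMatrix

/-- The product of a tridiagonal matrix and a sequence. -/
def mulVec (M : TridiagonalMatrix Z) (x : ℤ → Z) (j : ℤ) : Z :=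
  M.lower (j - 1) (x (j - 1)) + M.diag j (x j) + M.upper (j + 1) (x (j + 1))

theorem mulVec_smul (M : TridiagonalMatrix Z) (c : ℂ) (x : ℤ → Z) :
    M.mulVec (c • x) = c • M.mulVec x := by
  ext j
  simp [mulVec]

/-- The matrix `M` with row and column `p` moved to position `0`. -/
def translate (M : TridiagonalMatrix Z) (p : ℤ) : TridiagonalMatrix Z where
  lower j := M.lower (p + j)
  diag j := M.diag (p + j)
  upper j := M.upper (p + j)

theorem translate_mulVec (M : TridiagonalMatrix Z) (p : ℤ) (x : ℤ → Z) (j : ℤ) :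
    (M.translate p).mulVec (fun i => x (p + i)) j = M.mulVec x (p + j) := by
  simp only [mulVec, translate, add_sub_assoc, add_assoc]

/-- `M` has entries of norm at most `K`. -/
structure EntriesBoundedBy (M : TridiagonalMatrix Z) (K : ℝ) : Prop where
  norm_lower_le : ∀ j, ‖M.lower j‖ ≤ K
  norm_diag_le : ∀ j, ‖M.diag j‖ ≤ K
  norm_upper_le : ∀ j, ‖M.upper j‖ ≤ K

theorem EntriesBoundedBy.translate {M : TridiagonalMatrix Z} {K : ℝ} (h : M.EntriesBoundedBy K)
    (p : ℤ) : (M.translate p).EntriesBoundedBy K :=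
  ⟨fun _ => h.norm_lower_le _, fun _ => h.norm_diag_le _, fun _ => h.norm_upper_le _⟩

/-- In the coordinates `T`, the operator `A` acts as multiplication by `M`. -/
def Represents (M : TridiagonalMatrix Z) (T : ℤ → Y →L[ℂ] Z) (A : Y →L[ℂ] Y) : Prop :=
  ∀ y, (fun j => T j (A y)) = M.mulVec fun j => T j y

end TridiagonalMatrix

end TridiagonalMatrix

/-! ### Extremal orbits of tridiagonal operators -/

section Extremal

variable {Y Z : Type*} [NormedAddCommGroup Y] [NormedSpace ℂ Y] [NormedAddCommGroup Z]
  [NormedSpace ℂ Z]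

open TridiagonalMatrix

/-- A normalised orbit `G 0, G 1, …` of the inverse of a tridiagonal matrix, multiplied by `r`, that
starts from an almost extremal vector. -/
structure IsNearExtremal (M : TridiagonalMatrix Z) (K r ε : ℝ) (N : ℕ) (G : ℕ → ℤ → Z) :
    Prop where
  entriesBoundedBy : M.EntriesBoundedBy K
  recurrence : ∀ k, (r : ℂ) • G k = M.mulVec (G (k + 1))
  norm_zero : ‖G 0 0‖ = 1
  sq_norm_le : ∀ j, ‖G 0 j‖ ^ 2 ≤ dominationConst * 2 ^ j.natAbs
  rootMean_le : ∀ j, rootMean N (fun k => G k j) ≤ ‖G 0 j‖ ^ 2 + ε * 2 ^ j.natAbs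

theorem rootMean_smul (N : ℕ) (c : ℂ) (a : ℕ → Z) :
    rootMean N (c • a) = ‖c‖ ^ 2 * rootMean N a := by
  simp only [rootMean, Pi.smul_apply, smul_comm _ c, ← Finset.smul_sum, norm_smul, mul_pow,
    ← Finset.mul_sum, mul_div_assoc]

/-- The orbit is centred at a coordinate that dominates the others. -/
theorem exists_isNearExtremal_of_hasSum {M : TridiagonalMatrix Z} {K r ε : ℝ}
    (hM : M.EntriesBoundedBy K) {N : ℕ} {a : ℕ → ℤ → Z}
    (hrec : ∀ k, (r : ℂ) • a k = M.mulVec (a (k + 1))) {U E : ℝ} (hU : 0 < U) (hε : 0 < ε)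
    (hN : 0 < N) (hu : HasSum (fun j => ‖a 0 j‖ ^ 2) U)
    (he : HasSum (fun j => rootMean N (fun k => a k j) - ‖a 0 j‖ ^ 2) E)
    (hE : dominationConst * E ≤ ε * U) :
    ∃ (M' : TridiagonalMatrix Z) (G : ℕ → ℤ → Z), IsNearExtremal M' K r ε N G := by
  obtain ⟨p, hp0, hp⟩ := exists_dominating_index (fun j => sq_nonneg _)
    (fun j => sub_nonneg.2 (sq_norm_coeff_le_rootMean (fun k => a k j) hN)) hu he hU hε hE
  set c : ℂ := (‖a 0 p‖ : ℂ)⁻¹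
  have hc : ‖c‖ ^ 2 * ‖a 0 p‖ ^ 2 = 1 := by
    rw [← mul_pow, norm_inv, Complex.norm_real, norm_norm, inv_mul_cancel₀, one_pow]
    exact fun h => by simp [h] at hp0
  refine ⟨M.translate p, fun k j => c • a k (p + j), hM.translate p, fun k => ?_, ?_, fun j => ?_,
    fun j => ?_⟩
  · change (r : ℂ) • (c • fun j => a k (p + j))
      = (M.translate p).mulVec (c • fun j => a (k + 1) (p + j))
    rw [mulVec_smul, smul_comm]
    congr 1
    ext j
    rw [translate_mulVec, ← hrec]
    rfl
  · rw [← pow_eq_one_iff_of_nonneg (norm_nonneg _) two_ne_zero, norm_smul, mul_pow, add_zero, hc]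
  · calc ‖c • a 0 (p + j)‖ ^ 2 = ‖c‖ ^ 2 * ‖a 0 (p + j)‖ ^ 2 := by rw [norm_smul, mul_pow]
      _ ≤ ‖c‖ ^ 2 * (dominationConst * 2 ^ j.natAbs * ‖a 0 p‖ ^ 2) := by gcongr; exact (hp j).1
      _ = dominationConst * 2 ^ j.natAbs := by rw [mul_left_comm, hc, mul_one]
  · calc rootMean N (c • fun k => a k (p + j)) = ‖c‖ ^ 2 * rootMean N fun k => a k (p + j) :=
          rootMean_smul _ _ _
      _ ≤ ‖c‖ ^ 2 * (‖a 0 (p + j)‖ ^ 2 + ε * 2 ^ j.natAbs * ‖a 0 p‖ ^ 2) := by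
          gcongr
          linarith [(hp j).2]
      _ = ‖c • a 0 (p + j)‖ ^ 2 + ε * 2 ^ j.natAbs := by
          rw [mul_add, mul_left_comm, hc, mul_one, norm_smul, mul_pow]

theorem exists_isNearExtremal {T : ℤ → Y →L[ℂ] Z} (hT : IsL2Coord T) {σ r : ℝ} (hσ : 0 < σ)
    (hr : 0 ≤ r) (hrσ : 2 * r ≤ σ) (K : ℝ) {ε : ℝ} (hε : 0 < ε) (N₀ : ℕ) :
    ∃ δ : ℝ, 0 < δ ∧ ∀ (A B : Y →L[ℂ] Y) (M : TridiagonalMatrix Z), IsBoundedBelowOnDisc σ r A B →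
      M.EntriesBoundedBy K → M.Represents T A → ∀ y, ‖A y‖ < (σ + δ) * ‖y‖ →
      ∃ (N : ℕ) (M' : TridiagonalMatrix Z) (G : ℕ → ℤ → Z),
        N₀ < N ∧ IsNearExtremal M' K r ε N G := by
  obtain ⟨N, hN, δ, hδ, hmean⟩ := exists_hasSum_rootMean_sub_sq_norm hT hσ hr hrσ
    (div_pos hε dominationConst_pos) (N₀ + 1)
  refine ⟨δ, hδ, fun A B M hAB hM hMA y hy => ?_⟩
  obtain ⟨E, hE, he⟩ := hmean A B hAB y hy
  have hy0 : 0 < ‖y‖ := norm_pos_iff.2 fun h0 => by simp [h0] at hy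
  have hrec : ∀ k, (r : ℂ) • (fun j => T j ((((r : ℂ) • B) ^ k) y))
      = M.mulVec fun j => T j ((((r : ℂ) • B) ^ (k + 1)) y) := fun k => by
    rw [← hMA]
    ext j
    rw [pow_succ', mul_apply_eq_comp, _root_.smul_apply, map_smul, hAB.apply_apply, map_smul]
    rfl
  obtain ⟨M', G, h⟩ := exists_isNearExtremal_of_hasSum (N := N) (U := ‖y‖ ^ 2) hM hrec
    (by positivity) hε (by omega) (by simpa using hT y) (by simpa using he) (by
      rwa [← le_div_iff₀' dominationConst_pos, ← div_mul_eq_mul_div])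
  exact ⟨N, M', G, by omega, h⟩

end Extremal

section ExtremalLimit

variable {Y Z : Type*} [NormedAddCommGroup Y] [NormedSpace ℂ Y] [NormedAddCommGroup Z]
  [NormedSpace ℂ Z]

open TridiagonalMatrix

theorem exists_tendsto_of_eventually_norm_le {ι V : Type*} [NormedAddCommGroup V] [NormedSpace ℂ V]
    [FiniteDimensional ℂ V] {l : Ultrafilter ι} {x : ι → V} {R : ℝ} (hx : ∀ᶠ n in l, ‖x n‖ ≤ R) :
    ∃ v, Tendsto x l (𝓝 v) := by
  have : ProperSpace V := FiniteDimensional.proper ℂ V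
  obtain ⟨v, -, hv⟩ := (isCompact_closedBall (0 : V) R).ultrafilter_le_nhds (l.map x)
    (le_principal_iff.2 (hx.mono fun n hn => mem_closedBall_zero_iff.2 hn))
  exact ⟨v, hv⟩

theorem tendsto_clm_apply {ι V W : Type*} [NormedAddCommGroup V] [NormedSpace ℂ V]
    [NormedAddCommGroup W] [NormedSpace ℂ W] {l : Filter ι} {f : ι → V →L[ℂ] W} {x : ι → V}
    {f' : V →L[ℂ] W} {x' : V} (hf : Tendsto f l (𝓝 f')) (hx : Tendsto x l (𝓝 x')) :
    Tendsto (fun n => f n (x n)) l (𝓝 (f' x')) :=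
  (isBoundedBilinearMap_apply.continuous.tendsto (f', x')).comp (hf.prodMk_nhds hx)

theorem TridiagonalMatrix.exists_tendsto_mulVec [FiniteDimensional ℂ Z] {ι : Type*}
    (l : Ultrafilter ι) {M : ι → TridiagonalMatrix Z} {K : ℝ} (hM : ∀ n, (M n).EntriesBoundedBy K) :
    ∃ M' : TridiagonalMatrix Z, ∀ (x : ι → ℤ → Z) (x' : ℤ → Z),
      Tendsto x l (𝓝 x') → Tendsto (fun n => (M n).mulVec (x n)) l (𝓝 (M'.mulVec x')) := by
  choose α hα using fun j => exists_tendsto_of_eventually_norm_le (l := l)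
    (.of_forall fun n => (hM n).norm_lower_le j)
  choose β hβ using fun j => exists_tendsto_of_eventually_norm_le (l := l)
    (.of_forall fun n => (hM n).norm_diag_le j)
  choose γ hγ using fun j => exists_tendsto_of_eventually_norm_le (l := l)
    (.of_forall fun n => (hM n).norm_upper_le j)
  refine ⟨⟨α, β, γ⟩, fun x x' hx => ?_⟩
  rw [tendsto_pi_nhds] at hx ⊢
  exact fun j => ((tendsto_clm_apply (hα _) (hx _)).add (tendsto_clm_apply (hβ _) (hx _))).add
    (tendsto_clm_apply (hγ _) (hx _))

theorem IsNearExtremal.sq_norm_orbit_le {M : TridiagonalMatrix Z} {K r ε : ℝ} {N : ℕ}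
    {G : ℕ → ℤ → Z} (h : IsNearExtremal M K r ε N G) {k : ℕ} (hk : k < N) (j : ℤ) :
    ‖G k j‖ ^ 2 ≤ ‖G 0 j‖ ^ 2 + ε * 2 ^ j.natAbs :=
  (sq_norm_coeff_le_rootMean (fun k => G k j) hk).trans (h.rootMean_le j)

theorem IsNearExtremal.sq_norm_dual_orbit_le {M : TridiagonalMatrix Z} {K r ε : ℝ} {N : ℕ}
    {G : ℕ → ℤ → Z} (h : IsNearExtremal M K r ε N G) {j : ℤ} {φ : StrongDual ℂ Z} (hφ : ‖φ‖ ≤ 1)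
    (hφG : φ (G 0 j) = ‖G 0 j‖) {k : ℕ} (hk : 1 ≤ k) (hkN : k < N) :
    ‖φ (G k j)‖ ^ 2 ≤ ε * 2 ^ j.natAbs := by
  have hle := (sq_norm_add_sq_norm_le_rootMean (fun k => G k j) hφ hk hkN).trans (h.rootMean_le j)
  rwa [hφG, Complex.norm_real, norm_norm, add_le_add_iff_left] at hle

/-- A normalised orbit `G 0, G 1, …` of the inverse of a tridiagonal matrix, multiplied by `r`, that
starts from an extremal vector, with functionals `φ j` that norm the coordinates of that vector. -/
structure IsExtremal (M : TridiagonalMatrix Z) (r : ℝ) (G : ℕ → ℤ → Z) (φ : ℤ → StrongDual ℂ Z) :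
    Prop where
  recurrence : ∀ k, (r : ℂ) • G k = M.mulVec (G (k + 1))
  norm_zero : ‖G 0 0‖ = 1
  norm_orbit_le : ∀ k j, ‖G k j‖ ≤ ‖G 0 j‖
  dual_self : ∀ j, φ j (G 0 j) = ‖G 0 j‖
  dual_orbit : ∀ k, 1 ≤ k → ∀ j, φ j (G k j) = 0

theorem exists_tendsto_orbit [FiniteDimensional ℂ Z] {K r : ℝ} {N : ℕ → ℕ}
    {M : ℕ → TridiagonalMatrix Z} {G : ℕ → ℕ → ℤ → Z} (hN : ∀ n, n < N n)
    (h : ∀ n : ℕ, IsNearExtremal (M n) K r (1 / (n + 1)) (N n) (G n)) (k : ℕ) :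
    ∃ g : ℤ → Z, Tendsto (fun n => G n k) (hyperfilter ℕ : Filter ℕ) (𝓝 g) := by
  have hbound : ∀ j : ℤ, ∀ᶠ n in atTop,
      ‖G n k j‖ ≤ √(dominationConst * 2 ^ j.natAbs + 1 * 2 ^ j.natAbs) := fun j => by
    filter_upwards [eventually_ge_atTop k] with n hn
    refine Real.le_sqrt_of_sq_le (((h n).sq_norm_orbit_le (hn.trans_lt (hN n)) j).trans ?_)
    gcongr
    · exact (h n).sq_norm_le j
    · exact div_le_one_of_le₀ (by linarith [(n.cast_nonneg : (0 : ℝ) ≤ n)]) (by positivity)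
  choose g hg using fun j => exists_tendsto_of_eventually_norm_le
    ((hbound j).filter_mono Nat.hyperfilter_le_atTop)
  exact ⟨g, tendsto_pi_nhds.2 hg⟩

theorem exists_isExtremal [FiniteDimensional ℂ Z] {K r : ℝ} {N : ℕ → ℕ}
    {M : ℕ → TridiagonalMatrix Z} {G : ℕ → ℕ → ℤ → Z} (hN : ∀ n, n < N n)
    (h : ∀ n : ℕ, IsNearExtremal (M n) K r (1 / (n + 1)) (N n) (G n)) :
    ∃ (M' : TridiagonalMatrix Z) (G' : ℕ → ℤ → Z) (φ : ℤ → StrongDual ℂ Z),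
      IsExtremal M' r G' φ := by
  have hlarge : ∀ k, ∀ᶠ n in (hyperfilter ℕ : Filter ℕ), k < N n := fun k =>
    ((eventually_ge_atTop k).mono fun n hn => hn.trans_lt (hN n)).filter_mono
      Nat.hyperfilter_le_atTop
  have hε : ∀ j : ℤ, Tendsto (fun n : ℕ => 1 / ((n : ℝ) + 1) * 2 ^ j.natAbs)
      (hyperfilter ℕ : Filter ℕ) (𝓝 0) := fun j => by
    simpa using (tendsto_one_div_add_atTop_nhds_zero_nat.mono_left
      Nat.hyperfilter_le_atTop).mul_const ((2 : ℝ) ^ j.natAbs)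
  choose ψ hψ hψG using fun n j => exists_dual_vector'' ℂ (G n 0 j)
  obtain ⟨M', hM'⟩ := exists_tendsto_mulVec (hyperfilter ℕ) fun n => (h n).entriesBoundedBy
  choose G' hG' using exists_tendsto_orbit hN h
  choose φ hφ using fun j => exists_tendsto_of_eventually_norm_le (l := hyperfilter ℕ)
    (x := fun n => ψ n j) (.of_forall fun n => hψ n j)
  have hG : ∀ k j, Tendsto (fun n => G n k j) (hyperfilter ℕ : Filter ℕ) (𝓝 (G' k j)) :=
    fun k => tendsto_pi_nhds.1 (hG' k)
  refine ⟨M', G', φ, fun k => ?_, ?_, fun k j => ?_, fun j => ?_, fun k hk j => ?_⟩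
  · exact tendsto_nhds_unique ((hG' k).const_smul (r : ℂ))
      ((hM' _ _ (hG' (k + 1))).congr fun n => ((h n).recurrence k).symm)
  · exact tendsto_nhds_unique (hG 0 0).norm
      (tendsto_const_nhds.congr fun n => ((h n).norm_zero).symm)
  · rw [← sq_le_sq₀ (norm_nonneg _) (norm_nonneg _), ← add_zero (‖G' 0 j‖ ^ 2)]
    exact le_of_tendsto_of_tendsto ((hG k j).norm.pow 2) (((hG 0 j).norm.pow 2).add (hε j))
      ((hlarge k).mono fun n hn => (h n).sq_norm_orbit_le hn j)
  · exact tendsto_nhds_unique (tendsto_clm_apply (hφ j) (hG 0 j))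
      (((Complex.continuous_ofReal.tendsto _).comp (hG 0 j).norm).congr fun n => (hψG n j).symm)
  · rw [← norm_eq_zero, ← sq_eq_zero_iff]
    exact le_antisymm (le_of_tendsto_of_tendsto
      ((tendsto_clm_apply (hφ j) (hG k j)).norm.pow 2) (hε j)
      ((hlarge k).mono fun n hn => (h n).sq_norm_dual_orbit_le (hψ n j) (hψG n j) hk hn))
      (sq_nonneg _)

/-- The map that takes a functional `ψ` on `Z` to the sequence `k ↦ ψ (G k j)`. -/
noncomputable def orbitFunctionals (G : ℕ → ℤ → Z) (j : ℤ) : StrongDual ℂ Z →ₗ[ℂ] (ℕ → ℂ) where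
  toFun ψ k := ψ (G k j)
  map_add' _ _ := rfl
  map_smul' _ _ := rfl

namespace IsExtremal

variable {M : TridiagonalMatrix Z} {r : ℝ} {G : ℕ → ℤ → Z} {φ : ℤ → StrongDual ℂ Z}

theorem range_orbitFunctionals_eq_bot_or (h : IsExtremal M r G φ) (j : ℤ) :
    (orbitFunctionals G j).range = ⊥ ∨ Pi.single 0 1 ∈ (orbitFunctionals G j).range := by
  rcases eq_or_ne (G 0 j) 0 with h0 | h0
  · left
    have hG : ∀ k, G k j = 0 := fun k => by simpa [h0] using h.norm_orbit_le k j
    rw [LinearMap.range_eq_bot]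
    ext ψ k
    simp [orbitFunctionals, hG]
  · right
    refine ⟨(‖G 0 j‖ : ℂ)⁻¹ • φ j, ?_⟩
    ext (_ | k)
    · simp [orbitFunctionals, h.dual_self, h0]
    · simp [orbitFunctionals, h.dual_orbit (k + 1) (by omega) j]

theorem rightShift_orbitFunctionals (h : IsExtremal M r G φ) (j : ℤ)
    (ψ : StrongDual ℂ Z) :
    (r : ℂ) • rightShift ℂ (orbitFunctionals G j ψ)
      = orbitFunctionals G (j - 1) (ψ.comp (M.lower (j - 1)))
        + orbitFunctionals G j (ψ.comp (M.diag j))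
        + orbitFunctionals G (j + 1) (ψ.comp (M.upper (j + 1)))
        + (-ψ (M.mulVec (G 0) j)) • Pi.single 0 1 := by
  ext (_ | k)
  · simp [rightShift, orbitFunctionals, Function.extend_apply', mulVec]
  · have hrec := congrArg ψ (congrFun (h.recurrence k) j)
    simpa [rightShift, orbitFunctionals, Nat.succ_injective.extend_apply, mulVec] using hrec

theorem map_rightShift_le (h : IsExtremal M r G φ) (hr : r ≠ 0) (j : ℤ) :
    (orbitFunctionals G j).range.map (rightShift ℂ)
      ≤ (orbitFunctionals G (j - 1)).range ⊔ (orbitFunctionals G j).range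
        ⊔ (orbitFunctionals G (j + 1)).range ⊔ Submodule.span ℂ {Pi.single 0 1} := by
  rintro _ ⟨_, ⟨ψ, rfl⟩, rfl⟩
  rw [← Submodule.smul_mem_iff _ (Complex.ofReal_ne_zero.2 hr), h.rightShift_orbitFunctionals]
  exact Submodule.add_mem_sup (Submodule.add_mem_sup (Submodule.add_mem_sup ⟨_, rfl⟩ ⟨_, rfl⟩)
    ⟨_, rfl⟩) (Submodule.smul_mem _ _ (Submodule.mem_span_singleton_self _))

end IsExtremal

theorem not_isExtremal [FiniteDimensional ℂ Z] {M : TridiagonalMatrix Z} {r : ℝ} (hr : r ≠ 0)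
    {G : ℕ → ℤ → Z} {φ : ℤ → StrongDual ℂ Z} : ¬ IsExtremal M r G φ := fun h => by
  have hbot := eq_bot_of_map_rightShift_le (F := fun j => (orbitFunctionals G j).range)
    (fun j => LinearMap.finrank_range_le _) h.range_orbitFunctionals_eq_bot_or
    (h.map_rightShift_le hr)
  rw [LinearMap.range_eq_bot] at hbot
  have hφ : φ 0 (G 0 0) = 0 := congrFun (DFunLike.congr_fun hbot (φ 0)) 0
  simp [h.dual_self, h.norm_zero] at hφ

/-- The analogue of `ComplexUniformlyConvex.exists_add_mul_norm_le` for tridiagonal operators on an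
`ℓ²`-sum of copies of a finite-dimensional space. -/
theorem TridiagonalMatrix.exists_add_mul_norm_le [FiniteDimensional ℂ Z] {T : ℤ → Y →L[ℂ] Z}
    (hT : IsL2Coord T) {σ r : ℝ} (hσ : 0 < σ) (hr : 0 < r) (K : ℝ) :
    ∃ δ : ℝ, 0 < δ ∧ ∀ (A B : Y →L[ℂ] Y) (M : TridiagonalMatrix Z), M.EntriesBoundedBy K →
      M.Represents T A → IsBoundedBelowOnDisc σ r A B → ∀ y, (σ + δ) * ‖y‖ ≤ ‖A y‖ := by
  wlog hrσ : 2 * r ≤ σ generalizing r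
  · obtain ⟨δ, hδ, h⟩ := this (r := σ / 2) (by positivity) (by linarith)
    exact ⟨δ, hδ, fun A B M hM hMA hAB => h A B M hM hMA (hAB.mono (by linarith))⟩
  by_contra! hcon
  have hnear : ∀ n : ℕ, ∃ (N : ℕ) (M : TridiagonalMatrix Z) (G : ℕ → ℤ → Z),
      n < N ∧ IsNearExtremal M K r (1 / (n + 1)) N G := fun n => by
    obtain ⟨δ, hδ, h⟩ := exists_isNearExtremal hT hσ hr.le hrσ K (Nat.one_div_pos_of_nat (n := n)) n
    obtain ⟨A, B, M, hM, hMA, hAB, y, hy⟩ := hcon δ hδ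
    exact h A B M hAB hM hMA y hy
  choose N M G hN h using hnear
  obtain ⟨M', G', φ, hext⟩ := exists_isExtremal hN h
  exact not_isExtremal hr.ne' hext

end ExtremalLimit

/-! ### Globevnik's theorem -/

section Globevnik

variable {J Y Z : Type*} [NormedAddCommGroup Y] [NormedSpace ℂ Y] [NormedAddCommGroup Z]
  [NormedSpace ℂ Z]

section RecipNormInvPlateau

variable {A : Y →L[ℂ] Y} {σ r : ℝ} (hσ : 0 < σ) (hr : 0 ≤ r)
  (h : ∀ μ : ℂ, ‖μ‖ ≤ r → σ ≤ recipNormInv (A - μ • 1))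
include hσ hr h

theorem isUnit_of_forall_le_recipNormInv : IsUnit A := by
  have h0 := h 0 (by rwa [norm_zero])
  rw [zero_smul, sub_zero] at h0
  exact isUnit_of_recipNormInv_pos (hσ.trans_le h0)

variable [Nontrivial Y]

theorem isBoundedBelowOnDisc_of_forall_le_recipNormInv :
    IsBoundedBelowOnDisc σ r A (Ring.inverse A) where
  mul_eq_one := Ring.mul_inverse_cancel A (isUnit_of_forall_le_recipNormInv hσ hr h)
  mul_norm_le μ hμ := mul_norm_le_norm_apply (h μ hμ)

theorem isBoundedBelowOnDisc_dualOperator_of_forall_le_recipNormInv :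
    IsBoundedBelowOnDisc σ r (dualOperator A)
      (dualOperator (Ring.inverse A)) where
  mul_eq_one := by
    ext φ y
    exact congrArg φ (DFunLike.congr_fun (Ring.inverse_mul_cancel A
      (isUnit_of_forall_le_recipNormInv hσ hr h)) y)
  mul_norm_le μ hμ φ := by
    have hφ : φ.comp (A - μ • 1) = φ.comp A - μ • φ := by
      ext y
      simp
    exact (mul_norm_le_norm_comp (h μ hμ) φ).trans_eq (congrArg norm hφ)

end RecipNormInvPlateau

theorem exists_add_le_recipNormInv_of_complexUniformlyConvex [Nontrivial Y]
    (hZ : ComplexUniformlyConvex Z ∨ ComplexUniformlyConvex (StrongDual ℂ Z))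
    {T : J → Y →L[ℂ] Z} {ι : J → Z →L[ℂ] Y} (hT : IsL2Decomposition T ι) {σ r : ℝ} (hσ : 0 < σ)
    (hr : 0 < r) (K : ℝ) :
    ∃ δ : ℝ, 0 < δ ∧ ∀ A : Y →L[ℂ] Y, ‖A‖ ≤ K →
      (∀ μ : ℂ, ‖μ‖ ≤ r → σ ≤ recipNormInv (A - μ • 1)) → σ + δ ≤ recipNormInv A := by
  rcases hZ with hZ | hZ
  · obtain ⟨δ, hδ, h⟩ := hZ.exists_add_mul_norm_le hT.coord hσ hr K
    refine ⟨δ, hδ, fun A hA hlow => le_recipNormInv_of_isUnit (by positivity)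
      (isUnit_of_forall_le_recipNormInv hσ hr.le hlow) ?_⟩
    exact h A _ hA (isBoundedBelowOnDisc_of_forall_le_recipNormInv hσ hr.le hlow)
  · obtain ⟨δ, hδ, h⟩ := hZ.exists_add_mul_norm_le hT.isL2Coord_dualCoord hσ hr K
    refine ⟨δ, hδ, fun A hA hlow => le_recipNormInv_of_isUnit_of_comp (by positivity)
      (isUnit_of_forall_le_recipNormInv hσ hr.le hlow) ?_⟩
    exact h (dualOperator A) (dualOperator (Ring.inverse A)) ((norm_dualOperator_le A).trans hA)
      (isBoundedBelowOnDisc_dualOperator_of_forall_le_recipNormInv hσ hr.le hlow)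

theorem exists_add_le_recipNormInv_of_finiteDimensional [Nontrivial Y] [FiniteDimensional ℂ Z]
    {T : ℤ → Y →L[ℂ] Z} (hT : IsL2Coord T) {σ r : ℝ} (hσ : 0 < σ) (hr : 0 < r) (K : ℝ) :
    ∃ δ : ℝ, 0 < δ ∧ ∀ (A : Y →L[ℂ] Y) (M : TridiagonalMatrix Z), M.EntriesBoundedBy K →
      M.Represents T A → (∀ μ : ℂ, ‖μ‖ ≤ r → σ ≤ recipNormInv (A - μ • 1)) →
      σ + δ ≤ recipNormInv A := by
  obtain ⟨δ, hδ, h⟩ := TridiagonalMatrix.exists_add_mul_norm_le hT hσ hr K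
  exact ⟨δ, hδ, fun A M hM hMA hlow => le_recipNormInv_of_isUnit (by positivity)
    (isUnit_of_forall_le_recipNormInv hσ hr.le hlow)
    (h A _ M hM hMA (isBoundedBelowOnDisc_of_forall_le_recipNormInv hσ hr.le hlow))⟩

namespace TridiagonalMatrix

variable {M : TridiagonalMatrix Z} {T : ℤ → Y →L[ℂ] Z} {A : Y →L[ℂ] Y}

/-- The matrix `M - c I`. -/
def subScalar (M : TridiagonalMatrix Z) (c : ℂ) : TridiagonalMatrix Z :=
  { M with diag := fun j => M.diag j - c • 1 }

theorem EntriesBoundedBy.subScalar {K : ℝ} (h : M.EntriesBoundedBy K) (c : ℂ) :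
    (M.subScalar c).EntriesBoundedBy (K + ‖c‖) where
  norm_lower_le j := (h.norm_lower_le j).trans (le_add_of_nonneg_right (norm_nonneg c))
  norm_diag_le j := by
    refine (norm_sub_le _ _).trans (add_le_add (h.norm_diag_le j) ?_)
    rw [norm_smul]
    exact mul_le_of_le_one_right (norm_nonneg c) ContinuousLinearMap.norm_id_le
  norm_upper_le j := (h.norm_upper_le j).trans (le_add_of_nonneg_right (norm_nonneg c))

theorem Represents.subScalar (h : M.Represents T A) (c : ℂ) :
    (M.subScalar c).Represents T (A - c • 1) := fun y => by
  ext j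
  have hj : T j (A y) = M.mulVec (fun j => T j y) j := congrFun (h y) j
  simp only [sub_apply, smul_apply, one_apply_eq_self, map_sub, map_smul, hj, mulVec,
    TridiagonalMatrix.subScalar]
  abel

end TridiagonalMatrix

variable {X : Type*} [NormedAddCommGroup X] [NormedSpace ℂ X]

/-- The matrix representation of a tridiagonal operator on `ℓ²(ℤ, X)`. -/
noncomputable def tridiagonalMatrix (A : EllTwo X →L[ℂ] EllTwo X) : TridiagonalMatrix X where
  lower := subdiag A
  diag j := matrixEntry A j j
  upper := superdiag A

theorem entriesBoundedBy_tridiagonalMatrix (A : EllTwo X →L[ℂ] EllTwo X) :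
    (tridiagonalMatrix A).EntriesBoundedBy ‖A‖ :=
  ⟨fun _ => norm_matrixEntry_le A _ _, fun _ => norm_matrixEntry_le A _ _,
    fun _ => norm_matrixEntry_le A _ _⟩

theorem IsTridiagonal.represents {A : EllTwo X →L[ℂ] EllTwo X} (hA : IsTridiagonal A) :
    (tridiagonalMatrix A).Represents (fun j => lp.evalCLM ℂ (fun _ : ℤ => X) 2 j) A := fun x => by
  ext j
  have hsum : HasSum (fun i => matrixEntry A j i (x i)) (A x j) :=
    (isL2Decomposition_ellTwo.hasSum x).mapL ((lp.evalCLM ℂ (fun _ : ℤ => X) 2 j).comp A)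
  have hfin : HasSum (fun i => matrixEntry A j i (x i))
      (∑ i ∈ {j - 1, j, j + 1}, matrixEntry A j i (x i)) := by
    refine hasSum_sum_of_ne_finset_zero fun i hi => ?_
    simp only [Finset.mem_insert, Finset.mem_singleton, not_or] at hi
    rw [hA j i (by rw [lt_abs]; omega), zero_apply]
  have h := hsum.unique hfin
  rw [Finset.sum_insert (by simp; omega), Finset.sum_insert (by simp), Finset.sum_singleton,
    ← add_assoc] at h
  simp only [TridiagonalMatrix.mulVec, tridiagonalMatrix, subdiag, superdiag, sub_add_cancel,
    add_sub_cancel_right]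
  exact h

theorem isL2Coord_pi_single [DecidableEq J] (i : J) :
    IsL2Coord (Pi.single i 1 : J → Y →L[ℂ] Y) := fun y => by
  simpa using hasSum_single i (f := fun j => ‖(Pi.single i 1 : J → Y →L[ℂ] Y) j y‖ ^ 2)
    fun j hj => by simp [hj]

instance nontrivial_ellTwo [Nontrivial X] : Nontrivial (EllTwo X) := by
  obtain ⟨x, hx⟩ := exists_ne (0 : X)
  refine ⟨⟨lp.single 2 0 x, 0, fun h => hx ?_⟩⟩
  simpa using congrArg (fun y : EllTwo X => y 0) h

theorem nontrivial_piLp [Nontrivial X] {n : ℕ} (hn : 1 ≤ n) :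
    Nontrivial (PiLp 2 fun _ : Fin n => X) := by
  obtain ⟨x, hx⟩ := exists_ne (0 : X)
  refine ⟨⟨piLpSingle X ⟨0, hn⟩ x, 0, fun h => hx ?_⟩⟩
  simpa [piLpSingle_apply] using congrArg (fun y : PiLp 2 fun _ : Fin n => X => y ⟨0, hn⟩) h

namespace GlobevnikProperty

theorem lt_recipNormInv [Nontrivial X] (hX : GlobevnikProperty X)
    {A : EllTwo X →L[ℂ] EllTwo X} (hA : IsTridiagonal A) {σ r : ℝ} (hσ : 0 < σ) (hr : 0 < r)
    (lam : ℂ) (h : ∀ μ : ℂ, ‖μ - lam‖ ≤ r → σ ≤ recipNormInv (A - μ • 1)) :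
    σ < recipNormInv (A - lam • 1) := by
  have h' : ∀ μ : ℂ, ‖μ‖ ≤ r → σ ≤ recipNormInv (A - lam • 1 - μ • 1) := fun μ hμ => by
    rw [sub_sub, ← add_smul]
    exact h (lam + μ) (by rwa [add_sub_cancel_left])
  obtain ⟨δ, hδ, hle⟩ : ∃ δ : ℝ, 0 < δ ∧ σ + δ ≤ recipNormInv (A - lam • 1) := by
    rcases hX with hX | hX
    · obtain ⟨δ, hδ, hδ'⟩ := exists_add_le_recipNormInv_of_finiteDimensional
        (isL2Decomposition_ellTwo (X := X)).coord hσ hr (‖A‖ + ‖lam‖)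
      exact ⟨δ, hδ, hδ' _ _ ((entriesBoundedBy_tridiagonalMatrix A).subScalar lam)
        (hA.represents.subScalar lam) h'⟩
    · obtain ⟨δ, hδ, hδ'⟩ := exists_add_le_recipNormInv_of_complexUniformlyConvex hX
        isL2Decomposition_ellTwo hσ hr ‖A - lam • 1‖
      exact ⟨δ, hδ, hδ' _ le_rfl h'⟩
  linarith

theorem exists_add_le_recipNormInv [Nontrivial X] (hX : GlobevnikProperty X) {n : ℕ}
    (hn : 1 ≤ n) {σ r : ℝ} (hσ : 0 < σ) (hr : 0 < r) (K : ℝ) :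
    ∃ δ : ℝ, 0 < δ ∧ ∀ C : PiLp 2 (fun _ : Fin n => X) →L[ℂ] PiLp 2 (fun _ : Fin n => X), ‖C‖ ≤ K →
      (∀ μ : ℂ, ‖μ‖ ≤ r → σ ≤ recipNormInv (C - μ • 1)) → σ + δ ≤ recipNormInv C := by
  have := nontrivial_piLp (X := X) hn
  rcases hX with hX | hX
  · obtain ⟨δ, hδ, h⟩ := exists_add_le_recipNormInv_of_finiteDimensional
      (isL2Coord_pi_single (Y := PiLp 2 fun _ : Fin n => X) (0 : ℤ)) hσ hr (max K 0)
    refine ⟨δ, hδ, fun C hC => h C ⟨0, fun _ => C, 0⟩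
      ⟨by simp, fun _ => hC.trans (le_max_left K 0), by simp⟩ fun y => ?_⟩
    ext1 j
    by_cases hj : j = 0 <;> simp [TridiagonalMatrix.mulVec, Pi.single_apply, hj]
  · exact exists_add_le_recipNormInv_of_complexUniformlyConvex hX isL2Decomposition_piLp hσ hr K

end GlobevnikProperty

end Globevnik

/-! ### Sine weights -/

section SineWeights

/-- The weights `sin (π i / n)` by which a sequence is cut off to a window of length `n - 1`; they
vanish at `i = 0` and at `i = n`. -/
noncomputable def sineWeight (n i : ℕ) : ℝ := Real.sin (i * (Real.pi / n))

theorem sineWeight_zero (n : ℕ) : sineWeight n 0 = 0 := by simp [sineWeight]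

theorem sineWeight_self {n : ℕ} (hn : 0 < n) : sineWeight n n = 0 := by
  have h : (n : ℝ) * (Real.pi / n) = Real.pi := by field_simp
  rw [sineWeight, h, Real.sin_pi]

theorem sineWeight_one_pos {n : ℕ} (hn : 2 ≤ n) : 0 < sineWeight n 1 := by
  have hn' : (1 : ℝ) < n := by exact_mod_cast hn
  refine Real.sin_pos_of_pos_of_lt_pi (by positivity) ?_
  rw [Nat.cast_one, one_mul]
  exact div_lt_self Real.pi_pos hn'

theorem sineWeight_self_succ {n : ℕ} (hn : 0 < n) : sineWeight n (n + 1) = -sineWeight n 1 := by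
  have h : ((n + 1 : ℕ) : ℝ) * (Real.pi / n) = Real.pi / n + Real.pi := by
    push_cast
    field_simp
    ring
  rw [sineWeight, h, Real.sin_add_pi, sineWeight, Nat.cast_one, one_mul]

theorem sineWeight_recurrence (n i : ℕ) :
    sineWeight n (i + 2) + sineWeight n i = 2 * Real.cos (Real.pi / n) * sineWeight n (i + 1) := by
  have hsucc : ((i + 2 : ℕ) : ℝ) * (Real.pi / n)
      = ((i + 1 : ℕ) : ℝ) * (Real.pi / n) + Real.pi / n := by
    push_cast
    ring
  have hpred : (i : ℝ) * (Real.pi / n) = ((i + 1 : ℕ) : ℝ) * (Real.pi / n) - Real.pi / n := by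
    push_cast
    ring
  unfold sineWeight
  rw [hsucc, hpred, Real.sin_add, Real.sin_sub]
  ring

theorem sum_range_add_one_eq_sum_range {n : ℕ} {f : ℕ → ℝ} (h : f n = f 0) :
    ∑ i ∈ Finset.range n, f (i + 1) = ∑ i ∈ Finset.range n, f i := by
  rw [← sub_eq_zero, ← Finset.sum_sub_distrib, Finset.sum_range_sub, h, sub_self]

theorem sum_sineWeight_mul_sineWeight_succ {n : ℕ} (hn : 0 < n) :
    ∑ i ∈ Finset.range n, sineWeight n i * sineWeight n (i + 1)
      = Real.cos (Real.pi / n) * ∑ i ∈ Finset.range n, sineWeight n (i + 1) ^ 2 := by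
  have hshift := sum_range_add_one_eq_sum_range (n := n)
    (f := fun i => sineWeight n i * sineWeight n (i + 1))
    (by rw [sineWeight_self hn, sineWeight_zero, zero_mul, zero_mul])
  have hsum : ∑ i ∈ Finset.range n, sineWeight n (i + 1) * sineWeight n (i + 2)
      + ∑ i ∈ Finset.range n, sineWeight n i * sineWeight n (i + 1)
      = 2 * (Real.cos (Real.pi / n) * ∑ i ∈ Finset.range n, sineWeight n (i + 1) ^ 2) := by
    rw [← Finset.sum_add_distrib, Finset.mul_sum, Finset.mul_sum]
    refine Finset.sum_congr rfl fun i _ => ?_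
    linear_combination sineWeight n (i + 1) * sineWeight_recurrence n i
  linarith

theorem two_mul_sin_half_sq (x : ℝ) : (2 * Real.sin (x / 2)) ^ 2 = 2 - 2 * Real.cos x := by
  have hcos := Real.cos_two_mul (x / 2)
  rw [mul_div_cancel₀ x two_ne_zero, Real.cos_sq'] at hcos
  linear_combination 2 * hcos

/-- The `ℓ²`-norm of the sine weights. -/
noncomputable def sineWeightNorm (n : ℕ) : ℝ := √(∑ i ∈ Finset.range n, sineWeight n (i + 1) ^ 2)

theorem sq_sineWeightNorm (n : ℕ) :
    sineWeightNorm n ^ 2 = ∑ i ∈ Finset.range n, sineWeight n (i + 1) ^ 2 :=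
  Real.sq_sqrt (Finset.sum_nonneg fun _ _ => sq_nonneg _)

theorem sineWeightNorm_pos {n : ℕ} (hn : 2 ≤ n) : 0 < sineWeightNorm n :=
  Real.sqrt_pos.2 (Finset.sum_pos' (fun i _ => sq_nonneg _)
    ⟨0, Finset.mem_range.2 (by omega), pow_pos (sineWeight_one_pos hn) 2⟩)

theorem sum_sq_sineWeight_sub_succ {n : ℕ} (hn : 0 < n) :
    ∑ i ∈ Finset.range n, (sineWeight n i - sineWeight n (i + 1)) ^ 2
      = (2 * Real.sin (Real.pi / (2 * n)) * sineWeightNorm n) ^ 2 := by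
  have hshift := sum_range_add_one_eq_sum_range (n := n) (f := fun i => sineWeight n i ^ 2)
    (by rw [sineWeight_self hn, sineWeight_zero])
  rw [mul_pow, sq_sineWeightNorm, mul_comm (2 : ℝ) (n : ℝ), ← div_div, two_mul_sin_half_sq]
  simp_rw [sub_sq, Finset.sum_add_distrib, Finset.sum_sub_distrib, mul_assoc, ← Finset.mul_sum]
  rw [← hshift, sum_sineWeight_mul_sineWeight_succ hn]
  ring

theorem sum_sq_sineWeight_succ_sub {n : ℕ} (hn : 0 < n) :
    ∑ i ∈ Finset.range n, (sineWeight n (i + 2) - sineWeight n (i + 1)) ^ 2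
      = (2 * Real.sin (Real.pi / (2 * n)) * sineWeightNorm n) ^ 2 := by
  have hshift := sum_range_add_one_eq_sum_range (n := n)
    (f := fun i => (sineWeight n (i + 1) - sineWeight n i) ^ 2)
    (by simp [sineWeight_self hn, sineWeight_self_succ hn, sineWeight_zero])
  rw [← sum_sq_sineWeight_sub_succ hn, hshift]
  exact Finset.sum_congr rfl fun i _ => sub_sq_comm _ _

end SineWeights

/-! ### Norms of weighted windows -/

section WeightedWindows

theorem exists_lt_mul_of_hasSum_sq {κ : Type*} {f u v w y : κ → ℝ} {U V W Y ε : ℝ}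
    (hu0 : ∀ k, 0 ≤ u k) (hv0 : ∀ k, 0 ≤ v k) (hw0 : ∀ k, 0 ≤ w k) (hy0 : ∀ k, 0 ≤ y k)
    (hU0 : 0 ≤ U) (hV0 : 0 ≤ V) (hW0 : 0 ≤ W) (hY0 : 0 ≤ Y)
    (hf : ∀ k, f k ≤ u k + v k + w k) (hu : HasSum (fun k => u k ^ 2) (U ^ 2))
    (hv : HasSum (fun k => v k ^ 2) (V ^ 2)) (hw : HasSum (fun k => w k ^ 2) (W ^ 2))
    (hy : HasSum (fun k => y k ^ 2) (Y ^ 2)) (hlt : U + V + W < ε * Y) :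
    ∃ k, f k < ε * y k := by
  have minkowski : ∀ {p q : κ → ℝ} {P Q : ℝ}, (∀ k, 0 ≤ p k) → (∀ k, 0 ≤ q k) → 0 ≤ P → 0 ≤ Q →
      HasSum (fun k => p k ^ 2) (P ^ 2) → HasSum (fun k => q k ^ 2) (Q ^ 2) →
      ∃ C, 0 ≤ C ∧ C ≤ P + Q ∧ HasSum (fun k => (p k + q k) ^ 2) (C ^ 2) :=
    fun hp hq hP hQ hpP hqQ => by
      simpa only [Real.rpow_two] using Real.Lp_add_le_hasSum_of_nonneg one_le_two hp hq hP hQ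
        (by simpa only [Real.rpow_two] using hpP) (by simpa only [Real.rpow_two] using hqQ)
  obtain ⟨C, hC0, hC, huv⟩ := minkowski hu0 hv0 hU0 hV0 hu hv
  obtain ⟨D, hD0, hD, huvw⟩ := minkowski (fun k => add_nonneg (hu0 k) (hv0 k)) hw0 hC0 hW0 huv hw
  have hε : 0 < ε := pos_of_mul_pos_left (lt_of_le_of_lt (by positivity) hlt) hY0
  by_contra! hle
  have hεY : (ε * Y) ^ 2 ≤ D ^ 2 := by
    refine hasSum_le (fun k => ?_) (by simpa only [mul_pow] using hy.mul_left (ε ^ 2)) huvw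
    rw [← mul_pow]
    exact pow_le_pow_left₀ (mul_nonneg hε.le (hy0 k)) ((hle k).trans (hf k)) 2
  have := le_of_sq_le_sq hεY hD0
  linarith

/-- The vector of the terms `f (k + m i)` of a sequence, multiplied by the moduli of the weights
`w i`. -/
noncomputable def weightedTerms (n : ℕ) (w : ℕ → ℝ) (m : ℕ → ℤ) (f : ℤ → ℝ) (k : ℤ) :
    EuclideanSpace ℝ (Fin n) :=
  WithLp.toLp 2 fun i => |w i| * f (k + m i)

theorem hasSum_sq_norm_weightedTerms {n : ℕ} {w : ℕ → ℝ} {W : ℝ}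
    (hw : ∑ i ∈ Finset.range n, w i ^ 2 = W ^ 2) (m : ℕ → ℤ) {f : ℤ → ℝ} {F : ℝ}
    (hf : HasSum (fun j => f j ^ 2) (F ^ 2)) :
    HasSum (fun k => ‖weightedTerms n w m f k‖ ^ 2) ((W * F) ^ 2) := by
  simp only [weightedTerms, EuclideanSpace.norm_sq_eq, Real.norm_eq_abs, sq_abs, mul_pow]
  rw [← hw, Finset.sum_mul, Finset.sum_range]
  exact hasSum_sum fun i _ => ((Equiv.addRight (m i)).hasSum_iff.2 hf).mul_left _

end WeightedWindows

/-! ### Periodised sections -/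

section PeriodisedSections

namespace TridiagonalMatrix

variable {Z : Type*} [NormedAddCommGroup Z] [NormedSpace ℂ Z]

/-- The entry of a tridiagonal matrix in row `i` and column `j`. -/
def entry (M : TridiagonalMatrix Z) (i j : ℤ) : Z →L[ℂ] Z :=
  if i = j + 1 then M.lower j else if i = j then M.diag j else if i = j - 1 then M.upper j else 0

theorem entry_lower (M : TridiagonalMatrix Z) (j : ℤ) : M.entry (j + 1) j = M.lower j := by
  simp [entry]

theorem entry_diag (M : TridiagonalMatrix Z) (j : ℤ) : M.entry j j = M.diag j := by simp [entry]

theorem entry_upper (M : TridiagonalMatrix Z) (j : ℤ) : M.entry (j - 1) j = M.upper j := by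
  simp [entry, show j - 1 ≠ j + 1 by omega]

theorem entry_eq_zero (M : TridiagonalMatrix Z) {i j : ℤ} (hlower : i ≠ j + 1) (hdiag : i ≠ j)
    (hupper : i ≠ j - 1) : M.entry i j = 0 := by
  simp [entry, hlower, hdiag, hupper]

/-- The section of rows and columns `k + 1, …, k + n` of a tridiagonal matrix, with `c` added in the
top right and `d` added in the bottom left corner. -/
def periodised (M : TridiagonalMatrix Z) (c d : Z →L[ℂ] Z) (n : ℕ) (k : ℤ) :
    Fin n → Fin n → Z →L[ℂ] Z := fun i j =>
  M.entry (k + 1 + (i : ℕ)) (k + 1 + (j : ℕ))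
    + (if (i : ℕ) = 0 ∧ (j : ℕ) + 1 = n then c else 0)
    + (if (i : ℕ) + 1 = n ∧ (j : ℕ) = 0 then d else 0)

/-- The transposed matrix, acting on sequences of functionals. -/
noncomputable def transpose (M : TridiagonalMatrix Z) : TridiagonalMatrix (StrongDual ℂ Z) where
  lower j := dualOperator (M.upper (j + 1))
  diag j := dualOperator (M.diag j)
  upper j := dualOperator (M.lower (j - 1))

theorem transpose_entry (M : TridiagonalMatrix Z) (i j : ℤ) :
    M.transpose.entry i j = dualOperator (M.entry j i) := by
  ext φ z
  rcases eq_or_ne i (j + 1) with rfl | hlower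
  · have := M.entry_upper (j + 1)
    simp_all [entry_lower, transpose]
  rcases eq_or_ne i j with rfl | hdiag
  · simp [entry_diag, transpose]
  rcases eq_or_ne i (j - 1) with rfl | hupper
  · have := M.entry_lower (j - 1)
    simp_all [entry_upper, transpose]
  · simp [entry_eq_zero, hlower, hdiag, hdiag.symm, hupper, show j ≠ i + 1 by omega,
      show j ≠ i - 1 by omega]

theorem transpose_periodised (M : TridiagonalMatrix Z) (c d : Z →L[ℂ] Z) (n : ℕ) (k : ℤ) :
    M.transpose.periodised (dualOperator d) (dualOperator c) n k
      = fun i j => dualOperator (M.periodised c d n k j i) := by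
  ext i j φ z
  simp only [periodised, transpose_entry, and_comm (a := (j : ℕ) = 0), and_comm (b := (i : ℕ) = 0)]
  split_ifs <;> simp [add_right_comm]

end TridiagonalMatrix

variable {Z : Type*} [NormedAddCommGroup Z] [NormedSpace ℂ Z]

theorem sum_three_terms {V : Type*} [AddCommGroup V] {n i : ℕ} (hi : i < n) {f : ℕ → V}
    (h0 : f 0 = 0) (hf : ∀ j, j ≠ i → j ≠ i + 1 → j ≠ i + 2 → f j = 0) :
    ∑ j : Fin n, f (j + 1) = f i + f (i + 1) + if i + 1 = n then 0 else f (i + 2) := by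
  have hrange : ∑ j : Fin n, f (j + 1) = ∑ j ∈ Finset.range (n + 1), f j := by
    rw [Finset.sum_range_succ', h0, add_zero, Finset.sum_range]
  have hthree : ∑ j ∈ Finset.range (n + 2), f j = f i + f (i + 1) + f (i + 2) := by
    rw [← Finset.sum_subset (s₁ := {i, i + 1, i + 2})]
    · simp [add_assoc]
    · intro j hj
      simp only [Finset.mem_insert, Finset.mem_singleton] at hj
      rw [Finset.mem_range]
      omega
    · intro j _ hj
      simp only [Finset.mem_insert, Finset.mem_singleton, not_or] at hj
      exact hf j hj.1 hj.2.1 hj.2.2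
  rw [hrange]
  rw [Finset.sum_range_succ] at hthree
  split_ifs with h
  · subst h
    rw [add_zero]
    exact add_right_cancel hthree
  · rwa [hf (n + 1) (by omega) (by omega) (by omega), add_zero] at hthree

/-- The window of a sequence at the positions `k + 1, …, k + n`, with sine weights. -/
noncomputable def sineWindow (n : ℕ) (x : ℤ → Z) (k : ℤ) : PiLp 2 (fun _ : Fin n => Z) :=
  WithLp.toLp 2 fun i => (sineWeight n (i + 1) : ℂ) • x (k + 1 + (i : ℕ))

namespace TridiagonalMatrix

theorem sum_entry_sineWindow (M : TridiagonalMatrix Z) {n : ℕ} (x : ℤ → Z) (k : ℤ)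
    (i : Fin n) :
    ∑ j : Fin n, M.entry (k + 1 + (i : ℕ)) (k + 1 + (j : ℕ)) (sineWindow n x k j)
      = (sineWeight n i : ℂ) • M.lower (k + (i : ℕ)) (x (k + (i : ℕ)))
        + (sineWeight n (i + 1) : ℂ) • M.diag (k + 1 + (i : ℕ)) (x (k + 1 + (i : ℕ)))
        + if (i : ℕ) + 1 = n then 0
          else (sineWeight n (i + 2) : ℂ) • M.upper (k + 2 + (i : ℕ)) (x (k + 2 + (i : ℕ))) := by
  have h := sum_three_terms i.isLt (f := fun j =>
    (sineWeight n j : ℂ) • M.entry (k + 1 + (i : ℕ)) (k + (j : ℕ)) (x (k + (j : ℕ))))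
    (by simp [sineWeight_zero]) fun j h0 h1 h2 => by
      rw [M.entry_eq_zero (by omega) (by omega) (by omega), zero_apply, smul_zero]
  have hlower : M.entry (k + 1 + (i : ℕ)) (k + (i : ℕ)) = M.lower (k + (i : ℕ)) := by
    rw [← M.entry_lower, add_right_comm]
  have hdiag : M.entry (k + 1 + (i : ℕ)) (k + 1 + (i : ℕ)) = M.diag (k + 1 + (i : ℕ)) :=
    M.entry_diag _
  have hupper : M.entry (k + 1 + (i : ℕ)) (k + 2 + (i : ℕ)) = M.upper (k + 2 + (i : ℕ)) := by
    rw [← M.entry_upper]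
    congr 1
    ring
  have hsucc : ∀ j : ℕ, k + ((j + 1 : ℕ) : ℤ) = k + 1 + (j : ℤ) := fun j => by push_cast; ring
  have hsucc_succ : k + ((i + 2 : ℕ) : ℤ) = k + 2 + (i : ℕ) := by push_cast; ring
  simp only [hsucc_succ, hupper] at h
  simpa only [hsucc, hlower, hdiag, sineWindow, map_smul] using h

end TridiagonalMatrix

theorem blockOperator_periodised_sineWindow (M : TridiagonalMatrix Z) (c d : Z →L[ℂ] Z) {n : ℕ}
    (x : ℤ → Z) (k : ℤ) (i : Fin n) :
    blockOperator (M.periodised c d n k) (sineWindow n x k) i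
      = (sineWeight n i : ℂ) • M.lower (k + (i : ℕ)) (x (k + (i : ℕ)))
        + (sineWeight n (i + 1) : ℂ) • M.diag (k + 1 + (i : ℕ)) (x (k + 1 + (i : ℕ)))
        + if (i : ℕ) + 1 = n then (sineWeight n 1 : ℂ) • d (x (k + 1))
          else (sineWeight n (i + 2) : ℂ) • M.upper (k + 2 + (i : ℕ)) (x (k + 2 + (i : ℕ))) := by
  have hn : 0 < n := i.pos
  have htop : ∀ j : Fin n,
      (if (i : ℕ) = 0 ∧ (j : ℕ) + 1 = n then c else 0) (sineWindow n x k j) = 0 := fun j => by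
    split_ifs with h
    · simp [sineWindow, h.2, sineWeight_self hn]
    · rfl
  have hbottom : ∑ j : Fin n,
      (if (i : ℕ) + 1 = n ∧ (j : ℕ) = 0 then d else 0) (sineWindow n x k j)
        = if (i : ℕ) + 1 = n then (sineWeight n 1 : ℂ) • d (x (k + 1)) else 0 := by
    rw [Finset.sum_eq_single_of_mem ⟨0, hn⟩ (Finset.mem_univ _) fun j _ hj => ?_]
    · split_ifs <;> simp_all [sineWindow]
    · simp [show (j : ℕ) ≠ 0 from fun h => hj (Fin.ext h)]
  simp only [blockOperator_apply, TridiagonalMatrix.periodised, _root_.add_apply,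
    Finset.sum_add_distrib, htop, hbottom, M.sum_entry_sineWindow, add_zero]
  split_ifs <;> simp

/-- The three summands come from writing the weights of the neighbours of position `k + 1 + i` as
that of the position itself plus a difference. -/
theorem norm_blockOperator_periodised_sineWindow_apply_le {M : TridiagonalMatrix Z}
    {c d : Z →L[ℂ] Z} {a g : ℝ} (ha : ∀ j, ‖M.lower j‖ ≤ a) (hg : ∀ j, ‖M.upper j‖ ≤ g)
    (hd : ‖d‖ ≤ g) {n : ℕ} (x : ℤ → Z) (k : ℤ) (i : Fin n) :
    ‖blockOperator (M.periodised c d n k) (sineWindow n x k) i‖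
      ≤ |sineWeight n (i + 1)| * ‖M.mulVec x (k + 1 + (i : ℕ))‖
        + |sineWeight n i - sineWeight n (i + 1)| * (a * ‖x (k + (i : ℕ))‖)
        + |sineWeight n (i + 2) - sineWeight n (i + 1)|
          * (g * ‖x (k + if (i : ℕ) + 1 = n then 1 else 2 + (i : ℤ))‖) := by
  have hn : 0 < n := i.pos
  have hnorm : ∀ (s : ℝ) {b : ℝ} {B : Z →L[ℂ] Z} (z : Z), ‖B‖ ≤ b →
      ‖(s : ℂ) • B z‖ ≤ |s| * (b * ‖z‖) := fun s b B z hB => by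
    rw [norm_smul, Complex.norm_real, Real.norm_eq_abs]
    gcongr
    exact B.le_of_opNorm_le hB z
  have hsplit : blockOperator (M.periodised c d n k) (sineWindow n x k) i
      = (sineWeight n (i + 1) : ℂ) • M.mulVec x (k + 1 + (i : ℕ))
        + ((sineWeight n i - sineWeight n (i + 1) : ℝ) : ℂ) •
          M.lower (k + (i : ℕ)) (x (k + (i : ℕ)))
        + if (i : ℕ) + 1 = n then (sineWeight n 1 : ℂ) • d (x (k + 1))
          else ((sineWeight n (i + 2) - sineWeight n (i + 1) : ℝ) : ℂ) •
            M.upper (k + 2 + (i : ℕ)) (x (k + 2 + (i : ℕ))) := by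
    have hpred : k + 1 + (i : ℕ) - 1 = k + (i : ℤ) := by ring
    have hsucc : k + 1 + (i : ℕ) + 1 = k + 2 + (i : ℤ) := by ring
    rw [blockOperator_periodised_sineWindow, TridiagonalMatrix.mulVec, hpred, hsucc]
    split_ifs with hi
    · simp [hi, sineWeight_self hn]
    · push_cast
      module
  rw [hsplit]
  refine norm_add₃_le.trans (add_le_add_three ?_ (hnorm _ _ (ha _)) ?_)
  · rw [norm_smul, Complex.norm_real, Real.norm_eq_abs]
  · split_ifs with hi
    · rw [show (i : ℕ) + 2 = n + 1 by omega, hi, sineWeight_self_succ hn, sineWeight_self hn,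
        sub_zero, abs_neg]
      exact hnorm _ _ hd
    · rw [← add_assoc]
      exact hnorm _ _ (hg _)

theorem norm_blockOperator_periodised_sineWindow_le {M : TridiagonalMatrix Z}
    {c d : Z →L[ℂ] Z} {a g : ℝ} (ha : ∀ j, ‖M.lower j‖ ≤ a) (hg : ∀ j, ‖M.upper j‖ ≤ g)
    (hd : ‖d‖ ≤ g) (n : ℕ) (x : ℤ → Z) (k : ℤ) :
    ‖blockOperator (M.periodised c d n k) (sineWindow n x k)‖
      ≤ ‖weightedTerms n (fun i => sineWeight n (i + 1)) (fun i => 1 + i)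
          (fun j => ‖M.mulVec x j‖) k‖
        + ‖weightedTerms n (fun i => sineWeight n i - sineWeight n (i + 1)) (fun i => i)
          (fun j => a * ‖x j‖) k‖
        + ‖weightedTerms n (fun i => sineWeight n (i + 2) - sineWeight n (i + 1))
          (fun i => if i + 1 = n then 1 else 2 + i) (fun j => g * ‖x j‖) k‖ := by
  refine le_trans ?_ norm_add₃_le
  rw [PiLp.norm_eq_of_L2, EuclideanSpace.norm_eq]
  gcongr with i
  refine le_trans ?_ (le_abs_self _)
  refine (norm_blockOperator_periodised_sineWindow_apply_le ha hg hd x k i).trans_eq ?_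
  simp [weightedTerms, add_assoc]

theorem hasSum_sq_norm_sineWindow (n : ℕ) {x : ℤ → Z} {F : ℝ}
    (hx : HasSum (fun j => ‖x j‖ ^ 2) (F ^ 2)) :
    HasSum (fun k => ‖sineWindow n x k‖ ^ 2) ((sineWeightNorm n * F) ^ 2) := by
  convert hasSum_sq_norm_weightedTerms (sq_sineWeightNorm n).symm (fun i => 1 + i) hx using 1
  simp only [PiLp.norm_sq_eq_of_L2, sineWindow, weightedTerms, norm_smul, norm_mul,
    Complex.norm_real, Real.norm_eq_abs, abs_abs, abs_norm, add_assoc]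

end PeriodisedSections

/-! ### The inclusion of the pseudospectrum -/

section Inclusion

variable {Y Z : Type*} [NormedAddCommGroup Y] [NormedSpace ℂ Y] [NormedAddCommGroup Z]
  [NormedSpace ℂ Z]

theorem sin_pi_div_two_mul_nonneg (n : ℕ) : 0 ≤ Real.sin (Real.pi / (2 * n)) := by
  rcases Nat.eq_zero_or_pos n with rfl | hn
  · simp
  have hn' : (1 : ℝ) ≤ n := by exact_mod_cast hn
  exact Real.sin_nonneg_of_nonneg_of_le_pi (by positivity)
    (div_le_self Real.pi_pos.le (by linarith))

/-- The squares of the norms of all windows add up, so that an approximate eigenvector has a window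
that is an approximate eigenvector. -/
theorem exists_norm_blockOperator_periodised_lt {T : ℤ → Y →L[ℂ] Z} (hT : IsL2Coord T)
    {M : TridiagonalMatrix Z} {B : Y →L[ℂ] Y} (hM : M.Represents T B) {a g : ℝ}
    (ha : ∀ j, ‖M.lower j‖ ≤ a) (hg : ∀ j, ‖M.upper j‖ ≤ g) {c d : ℤ → Z →L[ℂ] Z}
    (hd : ∀ k, ‖d k‖ ≤ g) {n : ℕ} (hn : 2 ≤ n) {ε : ℝ} {y : Y}
    (hy : ‖B y‖ + 2 * (a + g) * Real.sin (Real.pi / (2 * n)) * ‖y‖ < ε * ‖y‖) :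
    ∃ (k : ℤ) (z : PiLp 2 (fun _ : Fin n => Z)),
      ‖blockOperator (M.periodised (c k) (d k) n k) z‖ < ε * ‖z‖ := by
  have hn0 : 0 < n := by omega
  have ha0 : 0 ≤ a := (norm_nonneg _).trans (ha 0)
  have hg0 : 0 ≤ g := (norm_nonneg _).trans (hg 0)
  have hδ0 : 0 ≤ Real.sin (Real.pi / (2 * n)) := sin_pi_div_two_mul_nonneg n
  have hS : 0 < sineWeightNorm n := sineWeightNorm_pos hn
  have hx : HasSum (fun j => ‖T j y‖ ^ 2) (‖y‖ ^ 2) := hT y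
  have hMx : HasSum (fun j => ‖M.mulVec (fun j => T j y) j‖ ^ 2) (‖B y‖ ^ 2) := by
    rw [← hM y]
    exact hT (B y)
  have hscale : ∀ b, HasSum (fun j => (b * ‖T j y‖) ^ 2) ((b * ‖y‖) ^ 2) := fun b => by
    simpa only [mul_pow] using hx.mul_left (b ^ 2)
  have hresidual := hasSum_sq_norm_weightedTerms (sq_sineWeightNorm n).symm
    (fun i : ℕ => (1 + i : ℤ)) hMx
  have hlower := hasSum_sq_norm_weightedTerms (sum_sq_sineWeight_sub_succ hn0)
    (fun i : ℕ => (i : ℤ)) (hscale a)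
  have hupper := hasSum_sq_norm_weightedTerms (sum_sq_sineWeight_succ_sub hn0)
    (fun i : ℕ => if i + 1 = n then (1 : ℤ) else 2 + i) (hscale g)
  have hlt : sineWeightNorm n * ‖B y‖
      + 2 * Real.sin (Real.pi / (2 * n)) * sineWeightNorm n * (a * ‖y‖)
      + 2 * Real.sin (Real.pi / (2 * n)) * sineWeightNorm n * (g * ‖y‖)
      < ε * (sineWeightNorm n * ‖y‖) := by
    have := mul_lt_mul_of_pos_left hy hS
    linarith
  have hbound := fun k => norm_blockOperator_periodised_sineWindow_le (c := c k) ha hg (hd k) n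
    (fun j => T j y) k
  have hwindow := hasSum_sq_norm_sineWindow n hx
  obtain ⟨k, hk⟩ := exists_lt_mul_of_hasSum_sq (fun _ => norm_nonneg _) (fun _ => norm_nonneg _)
    (fun _ => norm_nonneg _) (fun _ => norm_nonneg _) (mul_nonneg hS.le (norm_nonneg _))
    (by positivity) (by positivity) (by positivity) hbound hresidual hlower hupper hwindow hlt
  exact ⟨k, sineWindow n _ k, hk⟩

namespace TridiagonalMatrix

theorem subScalar_periodised (M : TridiagonalMatrix Z) (lam : ℂ) (c d : Z →L[ℂ] Z) (n : ℕ) (k : ℤ)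
    (i j : Fin n) :
    (M.subScalar lam).periodised c d n k i j
      = M.periodised c d n k i j - if i = j then lam • 1 else 0 := by
  have hentry : (M.subScalar lam).entry (k + 1 + (i : ℕ)) (k + 1 + (j : ℕ))
      = M.entry (k + 1 + (i : ℕ)) (k + 1 + (j : ℕ)) - if i = j then lam • 1 else 0 := by
    rcases eq_or_ne i j with rfl | hij
    · simp [entry, subScalar]
    · have hij' : k + 1 + (i : ℕ) ≠ k + 1 + ((j : ℕ) : ℤ) := fun h => hij (Fin.ext (by omega))
      simp [entry, subScalar, hij, hij']
  simp only [periodised, hentry]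
  abel

theorem blockOperator_subScalar_periodised (M : TridiagonalMatrix Z) (lam : ℂ) (c d : Z →L[ℂ] Z)
    (n : ℕ) (k : ℤ) :
    blockOperator ((M.subScalar lam).periodised c d n k)
      = blockOperator (M.periodised c d n k) - lam • 1 := by
  ext z i
  have hdiag : ∑ j, (if i = j then lam • 1 else 0 : Z →L[ℂ] Z) (z j) = lam • z i := by
    rw [Finset.sum_eq_single_of_mem i (Finset.mem_univ i) fun j _ hj => by simp [hj.symm]]
    simp
  simp [blockOperator_apply, subScalar_periodised, hdiag]

theorem Represents.apply_embedding {T : ℤ → Y →L[ℂ] Z} {ι : ℤ → Z →L[ℂ] Y}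
    (hT : IsL2Decomposition T ι) {M : TridiagonalMatrix Z} {B : Y →L[ℂ] Y} (h : M.Represents T B)
    (i j : ℤ) (z : Z) : T i (B (ι j z)) = M.entry i j z := by
  have hi : T i (B (ι j z)) = M.mulVec (fun i => T i (ι j z)) i := congrFun (h (ι j z)) i
  rw [hi, mulVec]
  rcases eq_or_ne i (j + 1) with rfl | hlower
  · simp [entry_lower, hT.apply_self, hT.apply_ne, add_assoc]
  rcases eq_or_ne i j with rfl | hdiag
  · simp [entry_diag, hT.apply_self, hT.apply_ne]
  rcases eq_or_ne i (j - 1) with rfl | hupper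
  · simp [entry_upper, hT.apply_self, hT.apply_ne, sub_sub]
  · simp [entry_eq_zero, hlower, hdiag, hupper, hT.apply_ne, show i - 1 ≠ j by omega,
      show i + 1 ≠ j by omega]

theorem Represents.transpose {T : ℤ → Y →L[ℂ] Z} {ι : ℤ → Z →L[ℂ] Y}
    (hT : IsL2Decomposition T ι) {M : TridiagonalMatrix Z} {B : Y →L[ℂ] Y} (h : M.Represents T B) :
    M.transpose.Represents (dualCoord ι) (dualOperator B) := fun φ => by
  ext j z
  have hsum : HasSum (fun i => φ (ι i (M.entry i j z))) (φ (B (ι j z))) := by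
    simpa only [h.apply_embedding hT] using (hT.hasSum (B (ι j z))).mapL φ
  have hfin : HasSum (fun i => φ (ι i (M.entry i j z)))
      (∑ i ∈ {j - 1, j, j + 1}, φ (ι i (M.entry i j z))) := by
    refine hasSum_sum_of_ne_finset_zero fun i hi => ?_
    simp only [Finset.mem_insert, Finset.mem_singleton, not_or] at hi
    simp [M.entry_eq_zero hi.2.2 hi.2.1 hi.1]
  have := hsum.unique hfin
  rw [Finset.sum_insert (by simp only [Finset.mem_insert, Finset.mem_singleton]; omega),
    Finset.sum_pair (by simp), entry_lower, entry_diag, entry_upper] at this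
  simpa [mulVec, TridiagonalMatrix.transpose, add_assoc] using this

end TridiagonalMatrix

variable {X : Type*} [NormedAddCommGroup X] [NormedSpace ℂ X]

/-- The functional `y ↦ ∑ j, ψ j (y j)` on `X^n`. -/
noncomputable def piLpFunctional {n : ℕ} (ψ : PiLp 2 (fun _ : Fin n => StrongDual ℂ X)) :
    StrongDual ℂ (PiLp 2 (fun _ : Fin n => X)) :=
  ∑ j, (ψ j).comp (PiLp.proj (𝕜 := ℂ) 2 (fun _ : Fin n => X) j)

theorem piLpFunctional_apply {n : ℕ} (ψ : PiLp 2 (fun _ : Fin n => StrongDual ℂ X))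
    (y : PiLp 2 (fun _ : Fin n => X)) : piLpFunctional ψ y = ∑ j, ψ j (y j) := by
  simp [piLpFunctional]

theorem norm_piLpFunctional {n : ℕ} (ψ : PiLp 2 (fun _ : Fin n => StrongDual ℂ X)) :
    ‖piLpFunctional ψ‖ = ‖ψ‖ := by
  have hcoord : ∀ j : Fin n, dualCoord (fun j => piLpSingle X j) j (piLpFunctional ψ) = ψ j :=
    fun j => by
      ext z
      rw [dualCoord_apply, ContinuousLinearMap.comp_apply, piLpFunctional_apply,
        Finset.sum_eq_single_of_mem j (Finset.mem_univ j) fun i _ hi => by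
          simp [piLpSingle_apply, hi], piLpSingle_apply, if_pos rfl]
  have hnorm := isL2Decomposition_piLp.isL2Coord_dualCoord (piLpFunctional ψ)
  simp only [hcoord] at hnorm
  rw [← sq_eq_sq₀ (norm_nonneg _) (norm_nonneg _), PiLp.norm_sq_eq_of_L2]
  exact hnorm.unique (hasSum_fintype _)

theorem piLpFunctional_comp_blockOperator {n : ℕ} (P : Fin n → Fin n → X →L[ℂ] X)
    (ψ : PiLp 2 (fun _ : Fin n => StrongDual ℂ X)) :
    (piLpFunctional ψ).comp (blockOperator P)
      = piLpFunctional (blockOperator (fun i j => dualOperator (P j i)) ψ) := by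
  ext y
  simp only [ContinuousLinearMap.comp_apply, piLpFunctional_apply, blockOperator_apply, map_sum,
    sum_apply, dualOperator_apply]
  exact Finset.sum_comm

theorem IsTridiagonal.entry_tridiagonalMatrix {A : EllTwo X →L[ℂ] EllTwo X} (hA : IsTridiagonal A)
    (i j : ℤ) : (tridiagonalMatrix A).entry i j = matrixEntry A i j :=
  ContinuousLinearMap.ext fun z =>
    (hA.represents.apply_embedding isL2Decomposition_ellTwo i j z).symm

theorem IsTridiagonal.periodisedSection_sub_smul {A : EllTwo X →L[ℂ] EllTwo X}
    (hA : IsTridiagonal A) (t lam : ℂ) (n : ℕ) (k : ℤ) :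
    periodisedSection A t n k - lam • 1
      = blockOperator (((tridiagonalMatrix A).subScalar lam).periodised (t • subdiag A k)
          (star t • superdiag A (k + n + 1)) n k) := by
  rw [TridiagonalMatrix.blockOperator_subScalar_periodised, sub_left_inj]
  refine congrArg blockOperator (funext₂ fun i j => ?_)
  rw [TridiagonalMatrix.periodised, hA.entry_tridiagonalMatrix]

theorem norm_subdiag_le_supNorm (A : EllTwo X →L[ℂ] EllTwo X) (j : ℤ) :
    ‖subdiag A j‖ ≤ supNorm (subdiag A) :=
  le_ciSup (bddAbove_subdiag A) j

theorem norm_superdiag_le_supNorm (A : EllTwo X →L[ℂ] EllTwo X) (j : ℤ) :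
    ‖superdiag A j‖ ≤ supNorm (superdiag A) :=
  le_ciSup (bddAbove_superdiag A) j

theorem supNorm_nonneg (x : ℤ → X →L[ℂ] X) : 0 ≤ supNorm x :=
  Real.iSup_nonneg fun _ => norm_nonneg _

theorem piPenalty_nonneg (A : EllTwo X →L[ℂ] EllTwo X) (n : ℕ) : 0 ≤ piPenalty A n :=
  mul_nonneg (mul_nonneg two_pos.le (add_nonneg (supNorm_nonneg _) (supNorm_nonneg _)))
    (sin_pi_div_two_mul_nonneg n)

variable [CompleteSpace X] [Nontrivial X]

theorem IsTridiagonal.exists_recipNormInv_periodisedSection_lt {A : EllTwo X →L[ℂ] EllTwo X}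
    (hA : IsTridiagonal A) {t : ℂ} (ht : ‖t‖ = 1) {lam : ℂ} {ε : ℝ}
    (h : recipNormInv (A - lam • 1) < ε) {n : ℕ} (hn : 2 ≤ n) :
    ∃ k, recipNormInv (periodisedSection A t n k - lam • 1) < ε + piPenalty A n := by
  have := nontrivial_piLp (X := X) (by omega : 1 ≤ n)
  have hε : 0 < ε := (recipNormInv_nonneg _).trans_lt h
  have hpos : 0 < ε + piPenalty A n := add_pos_of_pos_of_nonneg hε (piPenalty_nonneg A n)
  have hlower := norm_subdiag_le_supNorm A
  have hupper := norm_superdiag_le_supNorm A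
  have hcorner : ∀ k, ‖t • subdiag A k‖ ≤ supNorm (subdiag A) := fun k => by
    rw [norm_smul, ht, one_mul]
    exact hlower k
  have hcorner' : ∀ k, ‖star t • superdiag A k‖ ≤ supNorm (superdiag A) := fun k => by
    rw [norm_smul, norm_star, ht, one_mul]
    exact hupper k
  have hM := hA.represents.subScalar lam
  rcases (recipNormInv_lt_iff hε _).1 h with ⟨y, hy⟩ | ⟨φ, hφ⟩
  · obtain ⟨k, z, hz⟩ := exists_norm_blockOperator_periodised_lt isL2Decomposition_ellTwo.coord hM
      hlower hupper (c := fun k => t • subdiag A k) (fun k => hcorner' (k + n + 1)) hn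
      (ε := ε + piPenalty A n) (y := y) (by rw [piPenalty]; linarith)
    refine ⟨k, (recipNormInv_lt_iff hpos _).2 (.inl ⟨z, ?_⟩)⟩
    rwa [hA.periodisedSection_sub_smul]
  · obtain ⟨k, ψ, hψ⟩ := exists_norm_blockOperator_periodised_lt
      isL2Decomposition_ellTwo.isL2Coord_dualCoord (hM.transpose isL2Decomposition_ellTwo)
      (fun j => (norm_dualOperator_le _).trans (hupper (j + 1)))
      (fun j => (norm_dualOperator_le _).trans (hlower (j - 1)))
      (c := fun k => dualOperator (star t • superdiag A (k + n + 1)))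
      (fun k => (norm_dualOperator_le _).trans (hcorner k)) hn
      (ε := ε + piPenalty A n) (y := φ)
      (by rw [piPenalty, dualOperator_apply]; linarith)
    refine ⟨k, (recipNormInv_lt_iff hpos _).2 (.inr ⟨piLpFunctional ψ, ?_⟩)⟩
    rw [hA.periodisedSection_sub_smul, piLpFunctional_comp_blockOperator, norm_piLpFunctional,
      norm_piLpFunctional]
    rwa [TridiagonalMatrix.transpose_periodised] at hψ

end Inclusion

/-! ### Uniform invertibility in finite dimensions -/

section UniformInvertibility

theorem pow_card_le_norm_prod {r : ℝ} (hr : 0 ≤ r) (s : Multiset ℂ) (h : ∀ x ∈ s, r ≤ ‖x‖) :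
    r ^ s.card ≤ ‖s.prod‖ := by
  induction s using Multiset.induction with
  | empty => simp
  | cons a s ih =>
    rw [Multiset.card_cons, Multiset.prod_cons, norm_mul, pow_succ']
    exact mul_le_mul (h a (Multiset.mem_cons_self _ _))
      (ih fun x hx => h x (Multiset.mem_cons_of_mem hx)) (by positivity) (norm_nonneg _)

variable {W : Type*} [NormedAddCommGroup W] [NormedSpace ℂ W] [FiniteDimensional ℂ W]

theorem isUnit_iff_det_ne_zero {C : W →L[ℂ] W} : IsUnit C ↔ C.det ≠ 0 := by
  rw [← isUnit_iff_ne_zero, ContinuousLinearMap.det, ← LinearMap.isUnit_iff_isUnit_det,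
    Module.End.isUnit_iff]
  have : CompleteSpace W := FiniteDimensional.complete ℂ W
  exact ContinuousLinearMap.isUnit_iff_bijective

theorem pow_finrank_le_norm_det {C : W →L[ℂ] W} {r : ℝ} (hr : 0 ≤ r)
    (h : ∀ μ : ℂ, ‖μ‖ < r → IsUnit (C - μ • 1)) : r ^ Module.finrank ℂ W ≤ ‖C.det‖ := by
  have hsplits : (C : W →ₗ[ℂ] W).charpoly.Splits := IsAlgClosed.splits _
  have hdet : C.det = (C : W →ₗ[ℂ] W).charpoly.roots.prod :=
    Module.End.det_eq_prod_roots_charpoly_of_splits hsplits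
  rw [hdet, ← LinearMap.charpoly_natDegree (C : W →ₗ[ℂ] W), hsplits.natDegree_eq_card_roots]
  refine pow_card_le_norm_prod hr _ fun μ hμ => ?_
  by_contra! hlt
  obtain ⟨v, hv⟩ := (Module.End.hasEigenvalue_iff_isRoot_charpoly _ μ).2
    (Polynomial.isRoot_of_mem_roots hμ) |>.exists_hasEigenvector
  have : CompleteSpace W := FiniteDimensional.complete ℂ W
  refine hv.2 ((ContinuousLinearMap.isUnit_iff_bijective.1 (h μ hlt)).1 ?_)
  rw [map_zero, sub_apply, smul_apply, one_apply_eq_self, sub_eq_zero]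
  exact hv.apply_eq_smul

theorem exists_le_recipNormInv_of_isUnit {r : ℝ} (hr : 0 < r) (K : ℝ) [Nontrivial W] :
    ∃ δ : ℝ, 0 < δ ∧ ∀ C : W →L[ℂ] W, ‖C‖ ≤ K →
      (∀ μ : ℂ, ‖μ‖ < r → IsUnit (C - μ • 1)) → δ ≤ recipNormInv C := by
  have : ProperSpace (W →L[ℂ] W) := FiniteDimensional.proper ℂ _
  have : CompleteSpace W := FiniteDimensional.complete ℂ W
  have hcompact :
      IsCompact (Metric.closedBall 0 K ∩ {C : W →L[ℂ] W | r ^ Module.finrank ℂ W ≤ ‖C.det‖}) :=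
    (isCompact_closedBall 0 K).inter_right
      (isClosed_le continuous_const ContinuousLinearMap.continuous_det.norm)
  obtain ⟨δ, hδ, hmin⟩ := hcompact.exists_forall_le' continuous_recipNormInv.continuousOn
    (a := 0) fun C hC => by
      rw [← not_le, recipNormInv_le_zero_iff, not_not, isUnit_iff_det_ne_zero]
      exact norm_pos_iff.1 ((pow_pos hr _).trans_le hC.2)
  exact ⟨δ, hδ, fun C hC h =>
    hmin C ⟨mem_closedBall_zero_iff.2 hC, pow_finrank_le_norm_det hr.le h⟩⟩

end UniformInvertibility

/-! ### Convergence of the `π` method -/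

section PiMethod

variable {X : Type*} [NormedAddCommGroup X] [NormedSpace ℂ X]

theorem norm_blockOperator_le {n : ℕ} (M : Fin n → Fin n → X →L[ℂ] X) {c : ℝ} (hc : 0 ≤ c)
    (hM : ∀ i j, ‖M i j‖ ≤ c) : ‖blockOperator M‖ ≤ n * (n * c) := by
  refine ContinuousLinearMap.opNorm_le_bound _ (by positivity) fun x => ?_
  have hcoord : ∀ i, ‖blockOperator M x i‖ ≤ n * (c * ‖x‖) := fun i => by
    rw [blockOperator_apply]
    refine (norm_sum_le_of_le _ fun j _ => (M i j).le_of_opNorm_le_of_le (hM i j)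
      (PiLp.norm_apply_le x j)).trans_eq ?_
    simp
  rw [← sum_piLpSingle_apply (blockOperator M x)]
  refine (norm_sum_le_of_le _ fun i _ =>
    (isL2Decomposition_piLp.norm_apply i _).trans_le (hcoord i)).trans_eq ?_
  simp [mul_assoc]

theorem exists_norm_periodisedSection_le (A : EllTwo X →L[ℂ] EllTwo X) {t : ℂ} (ht : ‖t‖ = 1)
    (n : ℕ) : ∃ K : ℝ, ∀ k : ℤ, ‖periodisedSection A t n k‖ ≤ K := by
  refine ⟨n * (n * (‖A‖ + ‖A‖ + ‖A‖)), fun k => norm_blockOperator_le _ (by positivity)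
    fun i j => norm_add₃_le.trans (add_le_add_three (norm_matrixEntry_le A _ _) ?_ ?_)⟩
  · split_ifs
    · rw [norm_smul, ht, one_mul]
      exact norm_matrixEntry_le A _ _
    · simp
  · split_ifs
    · rw [norm_smul, norm_star, ht, one_mul]
      exact norm_matrixEntry_le A _ _
    · simp

theorem tendsto_piPenalty (A : EllTwo X →L[ℂ] EllTwo X) : Tendsto (piPenalty A) atTop (𝓝 0) := by
  have hangle : Tendsto (fun n : ℕ => Real.pi / (2 * (n : ℝ))) atTop (𝓝 0) :=
    tendsto_const_nhds.div_atTop (tendsto_natCast_atTop_atTop.const_mul_atTop two_pos)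
  have h := ((Real.continuous_sin.tendsto 0).comp hangle).const_mul
    (2 * (supNorm (subdiag A) + supNorm (superdiag A)))
  rw [Real.sin_zero, mul_zero] at h
  exact h

theorem piPenalty_pos {A : EllTwo X →L[ℂ] EllTwo X} {j : ℤ}
    (h : subdiag A j ≠ 0 ∨ superdiag A j ≠ 0) {n : ℕ} (hn : 1 ≤ n) : 0 < piPenalty A n := by
  have hn' : (1 : ℝ) ≤ n := by exact_mod_cast hn
  have hsin : 0 < Real.sin (Real.pi / (2 * n)) :=
    Real.sin_pos_of_pos_of_lt_pi (by positivity) (div_lt_self Real.pi_pos (by linarith))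
  refine mul_pos (mul_pos two_pos ?_) hsin
  rcases h with h | h
  · exact add_pos_of_pos_of_nonneg ((norm_pos_iff.2 h).trans_le (norm_subdiag_le_supNorm A j))
      (supNorm_nonneg _)
  · exact add_pos_of_nonneg_of_pos (supNorm_nonneg _)
      ((norm_pos_iff.2 h).trans_le (norm_superdiag_le_supNorm A j))

theorem piOpen_subset_piClosed (A : EllTwo X →L[ℂ] EllTwo X) (t : ℂ) (n : ℕ) (ε : ℝ) :
    piOpen A t n ε ⊆ piClosed A t n ε :=
  (Set.iUnion_mono fun _ => openPseudospectrum_subset_closedPseudospectrum _ _).trans subset_closure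

theorem exists_forall_lt_recipNormInv_of_notMem_piClosed {A : EllTwo X →L[ℂ] EllTwo X} {t : ℂ}
    {n : ℕ} {σ : ℝ} {lam : ℂ} (h : lam ∉ piClosed A t n σ) :
    ∃ r > 0, ∀ (k : ℤ) (μ : ℂ), ‖μ‖ < r →
      σ < recipNormInv (periodisedSection A t n k - lam • 1 - μ • 1) := by
  obtain ⟨r, hr, hball⟩ := Metric.isOpen_iff.1 isClosed_closure.isOpen_compl lam h
  refine ⟨r, hr, fun k μ hμ => ?_⟩
  by_contra! hle
  have hmem : lam + μ ∈ Metric.ball lam r := by simpa using hμ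
  exact hball hmem (subset_closure (Set.mem_iUnion.2 ⟨k, add_mem_closedPseudospectrum.2 hle⟩))

theorem hausdorffConverges_of_subset_thickening {S : ℕ → Set ℂ} {T : Set ℂ}
    (hne : ∀ n, 1 ≤ n → (S n).Nonempty) (hbdd : ∀ n, 1 ≤ n → Bornology.IsBounded (S n))
    (hT : T.Nonempty) (hST : ∀ δ : ℝ, 0 < δ → ∀ᶠ n in atTop, S n ⊆ Metric.thickening δ T)
    (hTS : ∀ᶠ n in atTop, T ⊆ S n) : HausdorffConverges S T := by
  obtain ⟨N, hN, hTN⟩ := ((eventually_ge_atTop 1).and hTS).exists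
  refine ⟨fun n hn => ⟨hne n hn, hbdd n hn⟩, hT, (hbdd N hN).subset hTN,
    Metric.tendsto_nhds.2 fun δ hδ => ?_⟩
  filter_upwards [hST (δ / 2) (half_pos hδ), hTS] with n hn hn'
  rw [Real.dist_eq, sub_zero, abs_of_nonneg Metric.hausdorffDist_nonneg]
  refine (Metric.hausdorffDist_le_of_mem_dist (half_pos hδ).le (fun x hx => ?_)
    fun x hx => ⟨x, hn' hx, by simpa using (half_pos hδ).le⟩).trans_lt (half_lt_self hδ)
  obtain ⟨y, hy, hxy⟩ := Metric.mem_thickening_iff.1 (hn hx)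
  exact ⟨y, hy, hxy.le⟩

variable [Nontrivial X]

theorem closedPseudospectrum_subset_closure_openPseudospectrum {A : EllTwo X →L[ℂ] EllTwo X}
    (hX : GlobevnikProperty X) (hA : IsTridiagonal A) {ε : ℝ} (hε : 0 < ε) :
    closedPseudospectrum ε A ⊆ closure (openPseudospectrum ε A) := by
  intro lam hlam
  by_contra hcon
  obtain ⟨r, hr, hball⟩ :=
    Metric.nhds_basis_closedBall.mem_iff.1 (isClosed_closure.isOpen_compl.mem_nhds hcon)
  refine (hX.lt_recipNormInv hA hε hr lam fun μ hμ => ?_).not_ge hlam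
  by_contra! hlt
  exact hball (mem_closedBall_iff_norm.2 hμ) (subset_closure hlt)

theorem GlobevnikProperty.exists_add_le_recipNormInv_of_pos_or_finiteDimensional
    (hX : GlobevnikProperty X) {n : ℕ} (hn : 1 ≤ n) {σ r : ℝ} (hσ : 0 ≤ σ)
    (hσX : 0 < σ ∨ FiniteDimensional ℂ X) (hr : 0 < r) (K : ℝ) :
    ∃ δ : ℝ, 0 < δ ∧ ∀ C : PiLp 2 (fun _ : Fin n => X) →L[ℂ] PiLp 2 (fun _ : Fin n => X), ‖C‖ ≤ K →
      (∀ μ : ℂ, ‖μ‖ < r → σ < recipNormInv (C - μ • 1)) → σ + δ ≤ recipNormInv C := by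
  have := nontrivial_piLp (X := X) hn
  rcases hσ.eq_or_lt with rfl | hpos
  · have hfin : FiniteDimensional ℂ X := hσX.resolve_left (lt_irrefl 0)
    obtain ⟨δ, hδ, h⟩ := exists_le_recipNormInv_of_isUnit
      (W := PiLp 2 (fun _ : Fin n => X)) hr K
    refine ⟨δ, hδ, fun C hC hμ => ?_⟩
    rw [zero_add]
    exact h C hC fun μ hμr => isUnit_of_recipNormInv_pos (hμ μ hμr)
  · obtain ⟨δ, hδ, h⟩ := hX.exists_add_le_recipNormInv hn hpos (half_pos hr) K
    exact ⟨δ, hδ, fun C hC hμ => h C hC fun μ hμr => (hμ μ (by linarith)).le⟩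

theorem openPseudospectrum_nonempty {Y : Type*} [NormedAddCommGroup Y] [NormedSpace ℂ Y]
    [CompleteSpace Y] [Nontrivial Y] (B : Y →L[ℂ] Y) {ε : ℝ} (hε : 0 < ε) :
    (openPseudospectrum ε B).Nonempty :=
  (exists_recipNormInv_sub_smul_eq_zero B).imp fun _ h => h.trans_lt hε

theorem closedPseudospectrum_nonempty {Y : Type*} [NormedAddCommGroup Y] [NormedSpace ℂ Y]
    [CompleteSpace Y] [Nontrivial Y] (B : Y →L[ℂ] Y) {ε : ℝ} (hε : 0 ≤ ε) :
    (closedPseudospectrum ε B).Nonempty :=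
  (exists_recipNormInv_sub_smul_eq_zero B).imp fun _ h => h.trans_le hε

variable [CompleteSpace X]

theorem piOpen_nonempty (A : EllTwo X →L[ℂ] EllTwo X) (t : ℂ) {n : ℕ} (hn : 1 ≤ n) {ε : ℝ}
    (hε : 0 < ε) : (piOpen A t n ε).Nonempty :=
  have := nontrivial_piLp (X := X) hn
  (openPseudospectrum_nonempty (periodisedSection A t n 0) hε).mono
    (Set.subset_iUnion_of_subset 0 subset_rfl)

theorem piClosed_nonempty (A : EllTwo X →L[ℂ] EllTwo X) (t : ℂ) {n : ℕ} (hn : 1 ≤ n) {ε : ℝ}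
    (hε : 0 ≤ ε) : (piClosed A t n ε).Nonempty :=
  have := nontrivial_piLp (X := X) hn
  ((closedPseudospectrum_nonempty (periodisedSection A t n 0) hε).mono
    (Set.subset_iUnion_of_subset 0 subset_rfl)).closure

theorem IsTridiagonal.openPseudospectrum_subset_piOpen {A : EllTwo X →L[ℂ] EllTwo X}
    (hA : IsTridiagonal A) {t : ℂ} (ht : ‖t‖ = 1) (ε : ℝ) {n : ℕ} (hn : 2 ≤ n) :
    openPseudospectrum ε A ⊆ piOpen A t n (ε + piPenalty A n) := fun _ h =>
  Set.mem_iUnion.2 (hA.exists_recipNormInv_periodisedSection_lt ht h hn)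

theorem IsTridiagonal.closedPseudospectrum_subset_piClosed {A : EllTwo X →L[ℂ] EllTwo X}
    (hA : IsTridiagonal A) (hX : GlobevnikProperty X) {t : ℂ} (ht : ‖t‖ = 1) {ε : ℝ} (hε : 0 ≤ ε)
    (h0 : 0 < ε ∨ FiniteDimensional ℂ X ∨ ∃ j : ℤ, subdiag A j ≠ 0 ∨ superdiag A j ≠ 0) {n : ℕ}
    (hn : 2 ≤ n) : closedPseudospectrum ε A ⊆ piClosed A t n (ε + piPenalty A n) := by
  intro lam hlam
  by_contra hnot
  obtain ⟨r, hr, hlt⟩ := exists_forall_lt_recipNormInv_of_notMem_piClosed hnot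
  obtain ⟨K, hK⟩ := exists_norm_periodisedSection_le A ht n
  have hn1 : 1 ≤ n := by omega
  have hpenalty : 0 ≤ piPenalty A n := piPenalty_nonneg A n
  have hσ : 0 < ε + piPenalty A n ∨ FiniteDimensional ℂ X := by
    rcases h0 with hε | hX | ⟨j, hj⟩
    · exact .inl (add_pos_of_pos_of_nonneg hε hpenalty)
    · exact .inr hX
    · exact .inl (add_pos_of_nonneg_of_pos hε (piPenalty_pos hj hn1))
  obtain ⟨δ, hδ, hle⟩ := hX.exists_add_le_recipNormInv_of_pos_or_finiteDimensional hn1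
    (add_nonneg hε hpenalty) hσ hr (K + ‖lam •
      (1 : PiLp 2 (fun _ : Fin n => X) →L[ℂ] PiLp 2 (fun _ : Fin n => X))‖)
  obtain ⟨k, hk⟩ := hA.exists_recipNormInv_periodisedSection_lt ht
    ((mem_closedPseudospectrum.1 hlam).trans_lt (lt_add_of_pos_right ε hδ)) hn
  have := hle _ ((norm_sub_le _ _).trans (add_le_add_left (hK k) _)) (hlt k)
  linarith

theorem piClosed_subset_closedPseudospectrum {A : EllTwo X →L[ℂ] EllTwo X} {t : ℂ} {n : ℕ} {η : ℝ}
    (h : ∀ ε : ℝ, 0 < ε → ∀ k : ℤ,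
      openPseudospectrum ε (periodisedSection A t n k) ⊆ openPseudospectrum (ε + η) A)
    {ε θ : ℝ} (hε : 0 ≤ ε) (hθ : 0 < θ) :
    piClosed A t n ε ⊆ closedPseudospectrum (ε + θ + η) A := by
  refine closure_minimal (Set.iUnion_subset fun k lam hlam => ?_)
    (isClosed_closedPseudospectrum _ A)
  exact openPseudospectrum_subset_closedPseudospectrum _ _
    (h (ε + θ) (by positivity) k (hlam.trans_lt (lt_add_of_pos_right ε hθ)))

namespace PiNoSpectralPollution

variable {A : EllTwo X →L[ℂ] EllTwo X} {t : ℂ}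

theorem isBounded_piClosed (h : PiNoSpectralPollution A t) {n : ℕ} (hn : 1 ≤ n) {ε : ℝ}
    (hε : 0 ≤ ε) : Bornology.IsBounded (piClosed A t n ε) := by
  obtain ⟨η, -, -, hη⟩ := h
  exact (isBounded_closedPseudospectrum _ A).subset
    (piClosed_subset_closedPseudospectrum (fun ε hε k => hη ε hε n hn k) hε one_pos)

theorem eventually_piClosed_subset_thickening (h : PiNoSpectralPollution A t) {ε δ : ℝ}
    (hε : 0 ≤ ε) (hδ : 0 < δ) :
    ∀ᶠ n in atTop, piClosed A t n (ε + piPenalty A n)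
      ⊆ Metric.thickening δ (closedPseudospectrum ε A) := by
  obtain ⟨η, -, hηlim, hη⟩ := h
  obtain ⟨θ, hθ, hθδ⟩ := exists_closedPseudospectrum_add_subset_thickening A ε hδ
  have hlim : Tendsto (fun n => piPenalty A n + η n) atTop (𝓝 0) := by
    simpa using (tendsto_piPenalty A).add hηlim
  filter_upwards [hlim.eventually_lt_const (half_pos hθ), eventually_ge_atTop 1] with n hn hn1
  intro lam hlam
  have hle := mem_closedPseudospectrum.1 (piClosed_subset_closedPseudospectrum
    (fun ε hε k => hη ε hε n hn1 k) (add_nonneg hε (piPenalty_nonneg A n)) (half_pos hθ) hlam)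
  exact hθδ (mem_closedPseudospectrum.2 (hle.trans (by linarith)))

end PiNoSpectralPollution

end PiMethod

theorem theorem1p4 {X : Type*} [NormedAddCommGroup X] [NormedSpace ℂ X] [CompleteSpace X]
    [Nontrivial X] (hX : GlobevnikProperty X)
    (A : EllTwo X →L[ℂ] EllTwo X) (hA : IsTridiagonal A)
    (t : ℂ) (ht : ‖t‖ = 1) (hpol : PiNoSpectralPollution A t) :
    (∀ ε : ℝ, 0 ≤ ε →
      (0 < ε ∨ FiniteDimensional ℂ X ∨ ∃ j : ℤ, subdiag A j ≠ 0 ∨ superdiag A j ≠ 0) →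
      HausdorffConverges (fun n => piClosed A t n (ε + piPenalty A n))
        (closedPseudospectrum ε A)) ∧
    (∀ ε : ℝ, 0 < ε →
      HausdorffConverges (fun n => piOpen A t n (ε + piPenalty A n))
        (openPseudospectrum ε A)) := by
  have hpenalty := piPenalty_nonneg A
  refine ⟨fun ε hε h0 => hausdorffConverges_of_subset_thickening
      (fun n hn => piClosed_nonempty A t hn (add_nonneg hε (hpenalty n)))
      (fun n hn => hpol.isBounded_piClosed hn (add_nonneg hε (hpenalty n)))
      (closedPseudospectrum_nonempty A hε)
      (fun δ hδ => hpol.eventually_piClosed_subset_thickening hε hδ)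
      ((eventually_ge_atTop 2).mono fun n hn =>
        hA.closedPseudospectrum_subset_piClosed hX ht hε h0 hn),
    fun ε hε => hausdorffConverges_of_subset_thickening
      (fun n hn => piOpen_nonempty A t hn (add_pos_of_pos_of_nonneg hε (hpenalty n)))
      (fun n hn => (hpol.isBounded_piClosed hn (add_nonneg hε.le (hpenalty n))).subset
        (piOpen_subset_piClosed A t n _))
      (openPseudospectrum_nonempty A hε) (fun δ hδ => ?_)
      ((eventually_ge_atTop 2).mono fun n hn => hA.openPseudospectrum_subset_piOpen ht ε hn)⟩
  have hthickening : Metric.thickening δ (closedPseudospectrum ε A)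
      ⊆ Metric.thickening δ (openPseudospectrum ε A) := by
    rw [← Metric.thickening_closure (s := openPseudospectrum ε A)]
    exact Metric.thickening_subset_of_subset δ
      (closedPseudospectrum_subset_closure_openPseudospectrum hX hA hε)
  filter_upwards [hpol.eventually_piClosed_subset_thickening hε.le hδ] with n hn
  exact (piOpen_subset_piClosed A t n _).trans (hn.trans hthickening)
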